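/- All graphs are finite, undirected and loopless, and may have parallel edges; $\deg_G(v)$ is the number of edges of $G$ incident with $v$ (parallel edges counted separately), and graphs are considered up to isomorphism. **Edge-admissibility.** For a vertex $x$ of $G$ and $S\subseteq V(G)\setminus\{x\}$, let $\mathrm{supp}_{G,\infty}(x,S)$ be the minimum size of a set $A\subseteq E(G)$ such that every path of $G$ from $x$ to a vertex of $S$ contains an edge of $A$. The edge-admissibility $\delta_{\rm e}^{\infty}(G)$ is the minimum, over all linear orderings $v_1,\dots,v_n$ of $V(G)$, of $\max_{1\le i\le n}\mathrm{supp}_{G,\infty}(v_i,\{v_1,\dots,v_{i-1}\})$ (it is $0$ if $V(G)=\emptyset$). **Edge sums.** Let $G_1,G_2$ be graphs, let $x_i\in V(G_i)$ with $\deg_{G_1}(x_1)=\deg_{G_2}(x_2)=k$, and let $\sigma$ be a bijection from the set of edges of $G_1$ at $x_1$ to the set of edges of $G_2$ at $x_2$. The $k$-edge sum of $G_1$ and $G_2$ on $x_1,x_2$ with respect to $\sigma$ is obtained from the disjoint union of $G_1$ and $G_2$ by deleting $x_1$ and $x_2$ and adding, for each edge $e=x_1a$ of $G_1$ with $\sigma(e)=x_2b$,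 a new edge $ab$. A graph is a $(\le k)$-edge sum of $G_1$ and $G_2$ if it is their disjoint union or, for some $1\le k'\le k$, a $k'$-edge sum of them (for some $x_1,x_2,\sigma$). **Closure.** For a graph class $\mathcal G$, let $\mathcal G^{(\le k)}$ be the smallest class of graphs that contains $\mathcal G$ and contains every graph $G$ that is a $(\le k)$-edge sum of two graphs $G_1,G_2\in\mathcal G^{(\le k)}$ with $|V(G_1)|,|V(G_2)|<|V(G)|$. Let $\mathcal A_k$ be the class of graphs in which all vertices, except possibly one, have degree at most $k$. **Theorem.** Let $G$ be a graph. 1. For every integer $k\ge 0$, if $\delta_{\rm e}^{\infty}(G)\le k$, then $G\in\mathcal A_k^{(\le k)}$. 2. For every integer $k\ge 1$, if $G\in\mathcal A_k^{(\le k)}$, then $\delta_{\rm e}^{\infty}(G)\le 2k-1$. -/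

import Mathlib

universe u v u₁ v₁ u₂ v₂

namespace Graph

/-- The standing convention: a finite multigraph without loops (parallel edges are allowed). -/
structure IsFiniteLoopless {α : Type u} {β : Type v} (G : Graph α β) : Prop where
  finite_vertexSet : V(G).Finite
  finite_edgeSet : E(G).Finite
  loopless : G.Loopless

/-- The edge-degree `deg_G(x) = |E_G(x)|`: the number of edges incident with `x`, counted with
multiplicity. -/
noncomputable def edgeDegree {α : Type u} {β : Type v} (G : Graph α β) (x : α) : ℕ∞ :=
  (G.incidenceSet x).encard

/-! ### Paths -/

/-- Walks of a multigraph; a walk records the edges that it traverses. -/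
inductive Walk {α : Type u} {β : Type v} (G : Graph α β) : α → α → Type (max u v)
  | nil {x : α} (hx : x ∈ V(G)) : Walk G x x
  | cons {x y z : α} (e : β) (h : G.IsLink e x y) (w : Walk G y z) : Walk G x z

namespace Walk

variable {α : Type u} {β : Type v} {G : Graph α β}

/-- The vertices of a walk, in order. -/
def support {x y : α} : G.Walk x y → List α
  | nil _ => [x]
  | cons _ _ w => x :: w.support

/-- The edges of a walk, in order. -/
def edges {x y : α} : G.Walk x y → List β
  | nil _ => []
  | cons e _ w => e :: w.edges

/-- The length of a walk is its number of edges. -/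
def length {x y : α} (w : G.Walk x y) : ℕ := w.edges.length

/-- A path is a walk that does not repeat a vertex. -/
def IsPath {x y : α} (w : G.Walk x y) : Prop := w.support.Nodup

/-- An `s`-path is a path of length at most `s`, where `s` may be infinite. -/
def IsSPath (s : ℕ∞) {x y : α} (w : G.Walk x y) : Prop := w.IsPath ∧ (w.length : ℕ∞) ≤ s

end Walk

/-! ### `s`-edge-degeneracy and `∞`-edge-admissibility -/

section Degeneracy

variable {α : Type u} {β : Type v}

/-- `A` is an `(s, x, S)`-edge-separator: a set of edges of `G` that meets every `s`-path of `G`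
from `x` to a vertex of `S`. -/
def IsEdgeSeparator (G : Graph α β) (s : ℕ∞) (x : α) (S : Set α) (A : Set β) : Prop :=
  A ⊆ E(G) ∧ ∀ y ∈ S, ∀ w : G.Walk x y, w.IsSPath s → ∃ e ∈ w.edges, e ∈ A

/-- `supp_{G,s}(x, S)`: the minimum size of an `(s, x, S)`-edge-separator. -/
noncomputable def edgeSupp (G : Graph α β) (s : ℕ∞) (x : α) (S : Set α) : ℕ∞ :=
  ⨅ A : {A : Set β // G.IsEdgeSeparator s x S A}, A.1.encard

/-- A layout `⟨v₁, …, vₙ⟩` (linear ordering) of the vertices of `G`, where `n = |V(G)|`. -/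
abbrev Layout (G : Graph α β) : Type u := Fin V(G).ncard ≃ V(G)

/-- The `s`-edge-degeneracy of a layout: the maximum over `i` of the `s`-edge-support of `vᵢ`,
which is `supp_{G,s}(vᵢ, {vⱼ | j < i})`. -/
noncomputable def layoutEdgeDegeneracy (G : Graph α β) (s : ℕ∞) (L : G.Layout) : ℕ∞ :=
  ⨆ i, G.edgeSupp s (L i) {x | ∃ j < i, x = L j}

/-- The `s`-edge-degeneracy `δₑˢ(G)`: the minimum over all layouts of `G`. -/
noncomputable def edgeDegeneracy (G : Graph α β) (s : ℕ∞) : ℕ∞ :=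
  ⨅ L : G.Layout, G.layoutEdgeDegeneracy s L

/-- The `∞`-edge-admissibility (for short, edge-admissibility) `δₑ^∞(G)`. -/
noncomputable def edgeAdmissibility (G : Graph α β) : ℕ∞ := G.edgeDegeneracy ⊤

end Degeneracy

/-! ### Edge sums -/

/-- Isomorphisms of multigraphs. -/
structure Iso {α₁ : Type u₁} {β₁ : Type v₁} {α₂ : Type u₂} {β₂ : Type v₂}
    (G : Graph α₁ β₁) (H : Graph α₂ β₂) where
  vertexEquiv : V(G) ≃ V(H)
  edgeEquiv : E(G) ≃ E(H)
  isLink_iff : ∀ (e : E(G)) (x y : V(G)),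
    G.IsLink e x y ↔ H.IsLink (edgeEquiv e) (vertexEquiv x) (vertexEquiv y)

section Sums

variable {α₁ : Type u₁} {β₁ : Type v₁} {α₂ : Type u₂} {β₂ : Type v₂}

/-- Incidences of the disjoint union. -/
inductive DisjointUnionLink (G₁ : Graph α₁ β₁) (G₂ : Graph α₂ β₂) :
    β₁ ⊕ β₂ → α₁ ⊕ α₂ → α₁ ⊕ α₂ → Prop
  | left {e : β₁} {x y : α₁} (h : G₁.IsLink e x y) :
      DisjointUnionLink G₁ G₂ (.inl e) (.inl x) (.inl y)
  | right {e : β₂} {x y : α₂} (h : G₂.IsLink e x y) :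
      DisjointUnionLink G₁ G₂ (.inr e) (.inr x) (.inr y)

/-- The disjoint union of two multigraphs. -/
def disjointUnion (G₁ : Graph α₁ β₁) (G₂ : Graph α₂ β₂) : Graph (α₁ ⊕ α₂) (β₁ ⊕ β₂) where
  vertexSet := Sum.inl '' V(G₁) ∪ Sum.inr '' V(G₂)
  IsLink := DisjointUnionLink G₁ G₂
  isLink_symm _ _ := ⟨by
    rintro _ _ (h | h)
    · exact .left h.symm
    · exact .right h.symm⟩
  eq_or_eq_of_isLink_of_isLink := by
    rintro _ _ _ _ _ (h | h) (h' | h')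
    · simpa using h.left_eq_or_eq h'
    · simpa using h.left_eq_or_eq h'
  left_mem_of_isLink := by
    rintro _ _ _ (h | h)
    · exact .inl ⟨_, h.left_mem, rfl⟩
    · exact .inr ⟨_, h.left_mem, rfl⟩

/-- Incidences of the edge sum of `G₁` and `G₂` on `x₁` and `x₂` with respect to `σ`. The edges not
incident with `x₁`, `x₂` are kept. An edge `e` from `x₁` to `a` and the edge `σ e` from `x₂` to `b`
are lifted to one new edge from `a` to `b`, which is named `Sum.inl e`. (In loopless graphs the
conditions `a ≠ x₁` and `b ≠ x₂` of the last two constructors hold automatically.) -/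
inductive EdgeSumLink (G₁ : Graph α₁ β₁) (G₂ : Graph α₂ β₂) (x₁ : α₁) (x₂ : α₂)
    (σ : G₁.incidenceSet x₁ ≃ G₂.incidenceSet x₂) : β₁ ⊕ β₂ → α₁ ⊕ α₂ → α₁ ⊕ α₂ → Prop
  | left {e : β₁} {a b : α₁} (h : G₁.IsLink e a b) (ha : a ≠ x₁) (hb : b ≠ x₁) :
      EdgeSumLink G₁ G₂ x₁ x₂ σ (.inl e) (.inl a) (.inl b)
  | right {e : β₂} {a b : α₂} (h : G₂.IsLink e a b) (ha : a ≠ x₂) (hb : b ≠ x₂) :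
      EdgeSumLink G₁ G₂ x₁ x₂ σ (.inr e) (.inr a) (.inr b)
  | lift {e : β₁} {a : α₁} {b : α₂} (he : e ∈ G₁.incidenceSet x₁) (h₁ : G₁.IsLink e x₁ a)
      (h₂ : G₂.IsLink (σ ⟨e, he⟩) x₂ b) (ha : a ≠ x₁) (hb : b ≠ x₂) :
      EdgeSumLink G₁ G₂ x₁ x₂ σ (.inl e) (.inl a) (.inr b)
  | lift' {e : β₁} {a : α₁} {b : α₂} (he : e ∈ G₁.incidenceSet x₁) (h₁ : G₁.IsLink e x₁ a)
      (h₂ : G₂.IsLink (σ ⟨e, he⟩) x₂ b) (ha : a ≠ x₁) (hb : b ≠ x₂) :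
      EdgeSumLink G₁ G₂ x₁ x₂ σ (.inl e) (.inr b) (.inl a)

/-- The edge sum of `G₁` and `G₂` on `x₁` and `x₂` with respect to the bijection `σ`: take the
disjoint union, identify `x₁` with `x₂`, lift `e` with `σ e` for every edge `e` at `x₁`, and remove
the identified vertex. -/
def edgeSum (G₁ : Graph α₁ β₁) (G₂ : Graph α₂ β₂) (x₁ : α₁) (x₂ : α₂)
    (σ : G₁.incidenceSet x₁ ≃ G₂.incidenceSet x₂) : Graph (α₁ ⊕ α₂) (β₁ ⊕ β₂) where
  vertexSet := Sum.inl '' (V(G₁) \ {x₁}) ∪ Sum.inr '' (V(G₂) \ {x₂})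
  IsLink := EdgeSumLink G₁ G₂ x₁ x₂ σ
  isLink_symm _ _ := ⟨by
    rintro _ _ (⟨h, ha, hb⟩ | ⟨h, ha, hb⟩ | ⟨he, h₁, h₂, ha, hb⟩ | ⟨he, h₁, h₂, ha, hb⟩)
    · exact .left h.symm hb ha
    · exact .right h.symm hb ha
    · exact .lift' he h₁ h₂ ha hb
    · exact .lift he h₁ h₂ ha hb⟩
  eq_or_eq_of_isLink_of_isLink := by
    rintro e x y z w h h'
    rcases h with ⟨h, ha, hb⟩ | ⟨h, ha, hb⟩ | ⟨he, h₁, h₂, ha, hb⟩ | ⟨he, h₁, h₂, ha, hb⟩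
    · cases h' with
      | left h' _ _ => simpa using h.left_eq_or_eq h'
      | lift _ h₁ _ _ _ => exact absurd (h₁.left_eq_or_eq h) (by tauto)
      | lift' _ h₁ _ _ _ => exact absurd (h₁.left_eq_or_eq h) (by tauto)
    · cases h' with
      | right h' _ _ => simpa using h.left_eq_or_eq h'
    · cases h' with
      | left h' _ _ => exact absurd (h₁.left_eq_or_eq h') (by tauto)
      | lift _ h₁' h₂' _ _ => exact .inl (congrArg _ (h₁.right_unique h₁'))
      | lift' _ h₁' h₂' _ _ => exact .inr (congrArg _ (h₁.right_unique h₁'))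
    · cases h' with
      | left h' _ _ => exact absurd (h₁.left_eq_or_eq h') (by tauto)
      | lift _ h₁' h₂' _ _ => exact .inr (congrArg _ (h₂.right_unique h₂'))
      | lift' _ h₁' h₂' _ _ => exact .inl (congrArg _ (h₂.right_unique h₂'))
  left_mem_of_isLink := by
    rintro _ _ _ (⟨h, ha, hb⟩ | ⟨h, ha, hb⟩ | ⟨he, h₁, h₂, ha, hb⟩ | ⟨he, h₁, h₂, ha, hb⟩)
    · exact .inl ⟨_, ⟨h.left_mem, ha⟩, rfl⟩
    · exact .inr ⟨_, ⟨h.left_mem, ha⟩, rfl⟩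
    · exact .inl ⟨_, ⟨h₁.right_mem, ha⟩, rfl⟩
    · exact .inr ⟨_, ⟨h₂.right_mem, hb⟩, rfl⟩

/-- `G` is (up to isomorphism) a `k`-edge sum of `G₁` and `G₂`, for some choice of vertices of
edge-degree `k` and of a bijection between the edges at them. -/
def IsEdgeSum {α : Type u} {β : Type v} (k : ℕ) (G : Graph α β) (G₁ : Graph α₁ β₁)
    (G₂ : Graph α₂ β₂) : Prop :=
  ∃ x₁ ∈ V(G₁), ∃ x₂ ∈ V(G₂), G₁.edgeDegree x₁ = k ∧ G₂.edgeDegree x₂ = k ∧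
    ∃ σ : G₁.incidenceSet x₁ ≃ G₂.incidenceSet x₂, Nonempty (Iso G (edgeSum G₁ G₂ x₁ x₂ σ))

/-- `G` is (up to isomorphism) a `(≤ k)`-edge sum of `G₁` and `G₂`: their disjoint union, or a
`k'`-edge sum of them for some `1 ≤ k' ≤ k`. -/
def IsEdgeSumLE {α : Type u} {β : Type v} (k : ℕ) (G : Graph α β) (G₁ : Graph α₁ β₁)
    (G₂ : Graph α₂ β₂) : Prop :=
  Nonempty (Iso G (disjointUnion G₁ G₂)) ∨ ∃ k', 1 ≤ k' ∧ k' ≤ k ∧ IsEdgeSum k' G G₁ G₂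

end Sums

/-! ### The `(≤ k)`-sum closure -/

/-- The `(≤ k)`-sum closure `𝒢^(≤k)` of a graph class `𝒢`: the smallest class that contains `𝒢` and
contains every graph that is a `(≤ k)`-edge sum of two graphs of the closure, each with fewer
vertices than the sum. -/
inductive EdgeSumClosure (𝒢 : ∀ ⦃α : Type u⦄ ⦃β : Type v⦄, Graph α β → Prop) (k : ℕ) :
    ∀ ⦃α : Type u⦄ ⦃β : Type v⦄, Graph α β → Prop
  | base {α : Type u} {β : Type v} {G : Graph α β} (h : 𝒢 G) : EdgeSumClosure 𝒢 k G
  | sum {α α₁ α₂ : Type u} {β β₁ β₂ : Type v} {G : Graph α β} {G₁ : Graph α₁ β₁}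
      {G₂ : Graph α₂ β₂} (h₁ : EdgeSumClosure 𝒢 k G₁) (h₂ : EdgeSumClosure 𝒢 k G₂)
      (hlt₁ : V(G₁).encard < V(G).encard) (hlt₂ : V(G₂).encard < V(G).encard)
      (h : IsEdgeSumLE k G G₁ G₂) : EdgeSumClosure 𝒢 k G

/-- The class `𝒜ₖ` of almost `k`-bounded edge-degree graphs: the (finite loopless multi)graphs
whose vertices, except possibly one, have edge-degree at most `k`. -/
def AlmostBoundedEdgeDegree (k : ℕ) ⦃α : Type u⦄ ⦃β : Type v⦄ (G : Graph α β) : Prop :=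
  G.IsFiniteLoopless ∧ {x ∈ V(G) | (k : ℕ∞) < G.edgeDegree x}.Subsingleton

end Graph

/-!
An ordering has edge-admissibility at most `k` if and only if every vertex `v` lies in a set of
vertices that are not earlier than `v` and whose edge cut has at most `k` edges: take the vertices
that can be reached from `v` without using the edges of a smallest separator. Both directions work
with such families of cuts, and both give the bound `k`.

If two vertices have degree more than `k`, let `s` be the last such vertex and let `X` be a smallest
cut among the sets of vertices that contain `s` and nothing earlier than `s`. Then `G` is the edge
sum of the graphs obtained by contracting either side of `X`, or a disjoint union if the cut is
empty. All vertices of `X` but `s` have degree at most `k`; on the other side, contracting `X` to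
`s` preserves admissibility of the ordering, because by submodularity any cut can be uncrossed with
`X` without becoming larger.

Conversely, by induction on the closure, every vertex of degree at most `k` can be moved to the
front of some admissible ordering. For an edge sum on `x₁` and `x₂`, this makes it possible to
substitute for `x₁` in an ordering of `G₁` an ordering of `G₂` that starts with `x₂`.
-/

namespace EdgeAdmissibility

open Graph

/-! ### Edge cuts -/

section Cuts

variable {α β : Type*} {G : Graph α β} {A B : Set α} {a b x : α} {e : β}

/-- The edge cut of `A`: the edges with one end in `A` and the other outside `A`. Here `A` is any
set in the ambient type of the vertices; only `A ∩ V(G)` matters. -/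
def cutSet (G : Graph α β) (A : Set α) : Set β :=
  {e | ∃ a b, G.IsLink e a b ∧ a ∈ A ∧ b ∉ A}

/-- The number of edges in the edge cut of `A`. -/
noncomputable def cutSize (G : Graph α β) (A : Set α) : ℕ∞ := (cutSet G A).encard

theorem cutSet_subset_edgeSet (G : Graph α β) (A : Set α) : cutSet G A ⊆ E(G) :=
  fun _ ⟨_, _, h, _⟩ ↦ h.edge_mem

theorem mem_cutSet_iff (h : G.IsLink e a b) : e ∈ cutSet G A ↔ ¬(a ∈ A ↔ b ∈ A) := by
  constructor
  · rintro ⟨c, d, hcd, hc, hd⟩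
    rcases h.eq_and_eq_or_eq_and_eq hcd with ⟨rfl, rfl⟩ | ⟨rfl, rfl⟩ <;> tauto
  · intro hn
    by_cases ha : a ∈ A
    · exact ⟨a, b, h, ha, by tauto⟩
    · exact ⟨b, a, h.symm, by tauto, ha⟩

@[simp] theorem cutSize_empty : cutSize G ∅ = 0 := by
  simp [cutSize, cutSet]

theorem cutSet_compl (G : Graph α β) (A : Set α) : cutSet G Aᶜ = cutSet G A := by
  refine Set.Subset.antisymm ?_ ?_ <;> rintro e ⟨a, b, h, ha, hb⟩ <;>
    exact ⟨b, a, h.symm, by simpa using hb, by simpa using ha⟩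

theorem cutSize_compl (G : Graph α β) (A : Set α) : cutSize G Aᶜ = cutSize G A := by
  rw [cutSize, cutSet_compl, cutSize]

theorem cutSize_congr (h : A ∩ V(G) = B ∩ V(G)) : cutSize G A = cutSize G B := by
  have hmem : ∀ v ∈ V(G), v ∈ A ↔ v ∈ B := fun v hv ↦ by
    simpa [hv] using Set.ext_iff.1 h v
  have hcut : cutSet G A = cutSet G B := by
    ext e
    constructor <;> rintro ⟨a, b, h, ha, hb⟩ <;> refine ⟨a, b, h, ?_, ?_⟩ <;>
      simp_all only [hmem a h.left_mem, hmem b h.right_mem, not_false_eq_true]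
  rw [cutSize, hcut, cutSize]

theorem cutSize_union_add_cutSize_inter_le (G : Graph α β) (A B : Set α) :
    cutSize G (A ∪ B) + cutSize G (A ∩ B) ≤ cutSize G A + cutSize G B := by
  unfold cutSize
  rw [← Set.encard_union_add_encard_inter (cutSet G (A ∪ B)),
    ← Set.encard_union_add_encard_inter (cutSet G A)]
  refine add_le_add (Set.encard_le_encard fun e he ↦ ?_) (Set.encard_le_encard fun e he ↦ ?_)
  · obtain ⟨a, b, h⟩ := exists_isLink_of_mem_edgeSet
      (he.elim (cutSet_subset_edgeSet G _ ·) (cutSet_subset_edgeSet G _ ·))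
    simp only [Set.mem_union, mem_cutSet_iff h, Set.mem_inter_iff] at he ⊢
    tauto
  · obtain ⟨a, b, h⟩ := exists_isLink_of_mem_edgeSet (cutSet_subset_edgeSet G _ he.1)
    simp only [Set.mem_union, mem_cutSet_iff h, Set.mem_inter_iff] at he ⊢
    tauto

theorem cutSize_sdiff_add_cutSize_sdiff_le (G : Graph α β) (A B : Set α) :
    cutSize G (A \ B) + cutSize G (B \ A) ≤ cutSize G A + cutSize G B := by
  have h := cutSize_union_add_cutSize_inter_le G A Bᶜ
  rw [cutSize_compl G B, ← cutSize_compl G (A ∪ Bᶜ), add_comm] at h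
  rwa [Set.compl_union, compl_compl, Set.inter_comm Aᶜ, ← Set.sdiff_eq, ← Set.sdiff_eq] at h

theorem cutSet_singleton_subset_incidenceSet (G : Graph α β) (x : α) :
    cutSet G {x} ⊆ G.incidenceSet x := by
  rintro e ⟨a, b, h, rfl, -⟩
  exact ⟨b, h⟩

theorem cutSize_singleton_le_edgeDegree (G : Graph α β) (x : α) :
    cutSize G {x} ≤ G.edgeDegree x :=
  Set.encard_le_encard (cutSet_singleton_subset_incidenceSet G x)

theorem cutSet_singleton [G.Loopless] (x : α) : cutSet G {x} = G.incidenceSet x :=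
  (cutSet_singleton_subset_incidenceSet G x).antisymm fun _ ⟨b, h⟩ ↦ ⟨x, b, h, rfl, h.ne.symm⟩

theorem edgeDegree_eq_cutSize_singleton [G.Loopless] (x : α) :
    G.edgeDegree x = cutSize G {x} := by
  rw [cutSize, cutSet_singleton, edgeDegree]

theorem cutSize_mono {H : Graph α β} (h : H ≤ G) (A : Set α) : cutSize H A ≤ cutSize G A :=
  Set.encard_le_encard fun _ ⟨a, b, hab, hA⟩ ↦ ⟨a, b, h.isLink_mono hab, hA⟩

/-- `η` names, for each edge of `H`, the edge of `G` that it comes from: edges inside the fibres of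
`φ` do not contribute to the cuts in question. -/
theorem cutSize_preimage {α' β' : Type*} {H : Graph α' β'} (φ : α → α') {η : E(H) → β}
    (hη : η.Injective)
    (exists_of_isLink : ∀ e a b, G.IsLink e a b → φ a ≠ φ b →
      ∃ e', η e' = e ∧ H.IsLink e' (φ a) (φ b))
    (exists_isLink : ∀ (e' : E(H)) a' b', H.IsLink e' a' b' →
      ∃ a b, G.IsLink (η e') a b ∧ φ a = a' ∧ φ b = b')
    (Y : Set α') : cutSize G (φ ⁻¹' Y) = cutSize H Y := by
  have h : cutSet G (φ ⁻¹' Y) = η '' (Subtype.val ⁻¹' cutSet H Y) := by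
    ext e
    constructor
    · rintro ⟨a, b, h, ha, hb⟩
      obtain ⟨e', rfl, h'⟩ := exists_of_isLink e a b h fun hab ↦ hb (show φ b ∈ Y from hab ▸ ha)
      exact ⟨e', ⟨_, _, h', ha, hb⟩, rfl⟩
    · rintro ⟨e', ⟨a', b', h', ha, hb⟩, rfl⟩
      obtain ⟨a, b, h, rfl, rfl⟩ := exists_isLink e' a' b' h'
      exact ⟨a, b, h, ha, hb⟩
  rw [cutSize, h, hη.encard_image, cutSize, ← Subtype.val_injective.encard_image,
    Subtype.image_preimage_coe, Set.inter_eq_right.2 (cutSet_subset_edgeSet H Y)]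

end Cuts

/-! ### Walks and cuts -/

section Walks

variable {α β : Type*} {G : Graph α β} {x y z : α}

theorem exists_isPath_of_mem_support (p : G.Walk x z) (hp : p.IsPath) (hy : y ∈ p.support) :
    ∃ q : G.Walk y z, q.IsPath ∧ q.edges ⊆ p.edges := by
  induction p with
  | nil hx =>
    obtain rfl : y = _ := by simpa [Walk.support] using hy
    exact ⟨.nil hx, hp, List.Subset.refl _⟩
  | @cons x _ _ e h w ih =>
    by_cases hyx : y = x
    · subst hyx
      exact ⟨.cons e h w, hp, List.Subset.refl _⟩
    · obtain ⟨q, hq, hqw⟩ := ih (List.nodup_cons.1 hp).2 ((List.mem_cons.1 hy).resolve_left hyx)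
      exact ⟨q, hq, List.subset_cons_of_subset _ hqw⟩

theorem exists_isPath_edges_subset (w : G.Walk x z) :
    ∃ p : G.Walk x z, p.IsPath ∧ p.edges ⊆ w.edges := by
  induction w with
  | nil hx => exact ⟨.nil hx, by simp [Walk.IsPath, Walk.support], List.Subset.refl _⟩
  | @cons x y z e h w ih =>
    obtain ⟨p, hp, hpw⟩ := ih
    by_cases hx : x ∈ p.support
    · obtain ⟨q, hq, hqp⟩ := exists_isPath_of_mem_support p hp hx
      exact ⟨q, hq, List.subset_cons_of_subset _ (List.Subset.trans hqp hpw)⟩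
    · exact ⟨.cons e h p, List.nodup_cons.2 ⟨hx, hp⟩, List.cons_subset_cons _ hpw⟩

theorem exists_edges_eq_append {f : β} (w : G.Walk x y) (hf : G.IsLink f y z) :
    ∃ p : G.Walk x z, p.edges = w.edges ++ [f] := by
  induction w with
  | nil hx => exact ⟨.cons f hf (.nil hf.right_mem), rfl⟩
  | cons e h w ih =>
    obtain ⟨p, hp⟩ := ih hf
    exact ⟨.cons e h p, by simp [Walk.edges, hp]⟩

theorem exists_mem_edges_mem_cutSet (w : G.Walk x y) {Y : Set α} (hx : x ∈ Y) (hy : y ∉ Y) :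
    ∃ e ∈ w.edges, e ∈ cutSet G Y := by
  induction w with
  | nil _ => exact absurd hx hy
  | @cons x z y e h w ih =>
    by_cases hz : z ∈ Y
    · obtain ⟨f, hf, hfY⟩ := ih hz hy
      exact ⟨f, List.mem_cons_of_mem _ hf, hfY⟩
    · exact ⟨e, List.mem_cons_self, x, z, h, hx, hz⟩

theorem edgeSupp_le_cutSize {S Y : Set α} (hx : x ∈ Y) (hYS : Disjoint Y S) :
    G.edgeSupp ⊤ x S ≤ cutSize G Y :=
  iInf_le (fun A : {A // G.IsEdgeSeparator ⊤ x S A} ↦ A.1.encard)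
    ⟨cutSet G Y, cutSet_subset_edgeSet G Y, fun _ hy w _ ↦
      exists_mem_edges_mem_cutSet w hx (hYS.notMem_of_mem_right hy)⟩

theorem exists_cutSize_le_edgeSupp {S : Set α} (hx : x ∈ V(G)) (hxS : x ∉ S) :
    ∃ Y, x ∈ Y ∧ Disjoint Y S ∧ cutSize G Y ≤ G.edgeSupp ⊤ x S := by
  have : Nonempty {A // G.IsEdgeSeparator ⊤ x S A} := by
    refine ⟨E(G), subset_rfl, fun y hy w _ ↦ ?_⟩
    cases w with
    | nil _ => exact absurd hy hxS
    | cons e h w => exact ⟨e, List.mem_cons_self, h.edge_mem⟩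
  obtain ⟨⟨A, hAE, hA⟩, hAmin⟩ := ENat.exists_eq_iInf
    (fun A : {A // G.IsEdgeSeparator ⊤ x S A} ↦ A.1.encard)
  refine ⟨{y | ∃ w : G.Walk x y, ∀ e ∈ w.edges, e ∉ A}, ⟨.nil hx, by simp [Walk.edges]⟩, ?_, ?_⟩
  · rw [Set.disjoint_left]
    rintro y ⟨w, hw⟩ hy
    obtain ⟨p, hp, hpw⟩ := exists_isPath_edges_subset w
    obtain ⟨e, he, heA⟩ := hA y hy p ⟨hp, le_top⟩
    exact hw e (hpw he) heA
  · rw [edgeSupp, ← hAmin]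
    refine Set.encard_le_encard ?_
    rintro e ⟨a, b, h, ⟨w, hw⟩, hb⟩
    by_contra he
    obtain ⟨p, hp⟩ := exists_edges_eq_append w h
    refine hb ⟨p, fun f hf ↦ ?_⟩
    rw [hp, List.mem_append, List.mem_singleton] at hf
    rcases hf with hf | rfl
    exacts [hw f hf, he]

end Walks

/-! ### Admissible rankings -/

section Ranks

/-- A vertex ordering, given by an injective ranking `r`, in which every vertex `v` can be separated
from its predecessors by at most `k` edges. The elements of `S` count as predecessors of all other
vertices whatever their rank, and nothing is asked of them: the ordering starts with `S`. -/
structure IsAdmissibleRank {α β ι : Type*} [LinearOrder ι] (G : Graph α β) (k : ℕ) (S : Set α)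
    (r : α → ι) : Prop where
  injOn : Set.InjOn r V(G)
  exists_cut : ∀ v ∈ V(G), v ∉ S →
    ∃ Y, v ∈ Y ∧ Disjoint Y S ∧ (∀ u ∈ Y, u ∈ V(G) → r v ≤ r u) ∧ cutSize G Y ≤ k

variable {α β ι : Type*} {G : Graph α β} {k : ℕ}

theorem IsAdmissibleRank.of_cutSize_le [LinearOrder ι] {S : Set α} {r : α → ι} {H : Graph α β}
    (hr : IsAdmissibleRank G k S r) (hV : V(H) ⊆ V(G)) (hcut : ∀ Y, cutSize H Y ≤ cutSize G Y) :
    IsAdmissibleRank H k S r where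
  injOn := hr.injOn.mono hV
  exists_cut v hv hvS := by
    obtain ⟨Y, hvY, hYS, hle, hYk⟩ := hr.exists_cut v (hV hv) hvS
    exact ⟨Y, hvY, hYS, fun u hu huH ↦ hle u hu (hV huH), (hcut Y).trans hYk⟩

theorem edgeAdmissibility_le_of_isAdmissibleRank [LinearOrder ι] {r : α → ι} (hG : V(G).Finite)
    (hr : IsAdmissibleRank G k ∅ r) : G.edgeAdmissibility ≤ k := by
  let _ : LinearOrder V(G) := LinearOrder.lift' (V(G).domRestrict r) hr.injOn.injective
  have : Fintype V(G) := hG.fintype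
  have hcard : Fintype.card V(G) = V(G).ncard := by
    rw [← Nat.card_eq_fintype_card, Nat.card_coe_set_eq]
  let L := monoEquivOfFin V(G) hcard
  refine (iInf_le _ L.toEquiv).trans (iSup_le fun i ↦ ?_)
  obtain ⟨Y, hvY, -, hle, hYk⟩ := hr.exists_cut (L i) (L i).2 (Set.notMem_empty _)
  refine (edgeSupp_le_cutSize hvY (Set.disjoint_right.2 ?_)).trans hYk
  rintro _ ⟨j, hj, rfl⟩ hjY
  exact (L.lt_iff_lt.2 hj).not_ge (hle _ hjY (L j).2)

open Classical in
theorem exists_isAdmissibleRank_of_edgeAdmissibility_le (h : G.edgeAdmissibility ≤ k) :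
    ∃ r : α → ℕ, IsAdmissibleRank G k ∅ r := by
  have : Nonempty G.Layout := by
    by_contra hne
    rw [not_nonempty_iff] at hne
    rw [edgeAdmissibility, edgeDegeneracy, iInf_of_empty, top_le_iff] at h
    exact ENat.natCast_ne_top k h
  obtain ⟨L, hL⟩ := ENat.exists_eq_iInf (G.layoutEdgeDegeneracy ⊤)
  let r : α → ℕ := fun a ↦ if h : a ∈ V(G) then L.symm ⟨a, h⟩ else 0
  have hrL : ∀ i, r (L i) = i := fun i ↦ by simp [r]
  have hLr : ∀ v ∈ V(G), ∃ i, L i = v := fun v hv ↦ ⟨L.symm ⟨v, hv⟩, by simp⟩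
  refine ⟨r, fun u hu v hv huv ↦ ?_, fun v hv _ ↦ ?_⟩
  · obtain ⟨i, rfl⟩ := hLr u hu
    obtain ⟨j, rfl⟩ := hLr v hv
    rw [hrL, hrL] at huv
    rw [Fin.ext huv]
  · obtain ⟨i, rfl⟩ := hLr v hv
    have hi : (L i : α) ∉ {x : α | ∃ j < i, x = L j} := fun ⟨j, hj, hij⟩ ↦
      hj.ne' (L.injective (Subtype.val_injective hij))
    obtain ⟨Y, hiY, hY, hYk⟩ := exists_cutSize_le_edgeSupp hv hi
    refine ⟨Y, hiY, Set.disjoint_empty Y, fun u hu huG ↦ ?_, hYk.trans ?_⟩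
    · obtain ⟨j, rfl⟩ := hLr u huG
      rw [hrL, hrL]
      exact not_lt.1 fun hji ↦ Set.disjoint_left.1 hY hu ⟨j, hji, rfl⟩
    · exact (le_iSup (fun i ↦ G.edgeSupp ⊤ (L i) {x | ∃ j < i, x = L j}) i).trans
        (hL.trans_le h)

end Ranks

/-! ### Orderings with a prescribed first vertex -/

section CutContractions

variable {α α₁ α₂ β β₁ β₂ ι₁ ι₂ : Type*} {G : Graph α β} {G₁ : Graph α₁ β₁} {G₂ : Graph α₂ β₂}
  {φ₁ : α → α₁} {φ₂ : α → α₂} {x₁ : α₁} {x₂ : α₂} {k : ℕ}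

/-- As far as edge cuts are concerned, `φ` contracts the vertices in the fibre over `x` to the
vertex `x` and turns `G` into `H`. -/
structure IsCutContraction (G : Graph α β) (H : Graph α₁ β₁) (φ : α → α₁) (x : α₁) : Prop where
  mapsTo : Set.MapsTo φ V(G) V(H)
  eq_of_apply_eq : ∀ u ∈ V(G), ∀ v ∈ V(G), φ u = φ v → φ v ≠ x → u = v
  cutSize_preimage : ∀ Y, cutSize G (φ ⁻¹' Y) = cutSize H Y

theorem IsCutContraction.isAdmissibleRank_toLex [LinearOrder ι₁] [LinearOrder ι₂] {r₁ : α₁ → ι₁}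
    {r₂ : α₂ → ι₂} {S : Set α} (h₁ : IsCutContraction G G₁ φ₁ x₁)
    (h₂ : IsCutContraction G G₂ φ₂ x₂) (hφ : ∀ v ∈ V(G), φ₁ v = x₁ ↔ φ₂ v ≠ x₂)
    (hr₁ : IsAdmissibleRank G₁ k (φ₁ '' S) r₁) (hr₂ : IsAdmissibleRank G₂ k {x₂} r₂)
    (hSG : S ⊆ V(G)) (hSx₁ : ∀ v ∈ S, φ₁ v ≠ x₁) :
    IsAdmissibleRank G k S fun v ↦ toLex (r₁ (φ₁ v), r₂ (φ₂ v)) := by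
  refine ⟨fun u hu v hv huv ↦ ?_, fun v hv hvS ↦ ?_⟩
  · obtain ⟨huv₁, huv₂⟩ := Prod.mk.inj (toLex_inj.1 huv)
    by_cases hvx : φ₁ v = x₁
    · exact h₂.eq_of_apply_eq u hu v hv (hr₂.injOn (h₂.mapsTo hu) (h₂.mapsTo hv) huv₂)
        ((hφ v hv).1 hvx)
    · exact h₁.eq_of_apply_eq u hu v hv (hr₁.injOn (h₁.mapsTo hu) (h₁.mapsTo hv) huv₁) hvx
  by_cases hvx : φ₁ v = x₁
  · obtain ⟨Y, hvY, hYx, hle, hYk⟩ := hr₂.exists_cut (φ₂ v) (h₂.mapsTo hv) ((hφ v hv).1 hvx)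
    have hYx₂ : ∀ u, φ₂ u ∈ Y → φ₂ u ≠ x₂ := fun u hu ↦ hYx.notMem_of_mem_left hu
    refine ⟨φ₂ ⁻¹' Y, hvY, Set.disjoint_left.2 fun u hu huS ↦ ?_, fun u hu huG ↦ ?_,
      (h₂.cutSize_preimage Y).trans_le hYk⟩
    · exact hSx₁ u huS ((hφ u (hSG huS)).2 (hYx₂ u hu))
    · rw [Prod.Lex.toLex_le_toLex, hvx, (hφ u huG).2 (hYx₂ u hu)]
      exact .inr ⟨rfl, hle _ hu (h₂.mapsTo huG)⟩
  · have hvS₁ : φ₁ v ∉ φ₁ '' S := by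
      rintro ⟨u, hu, huv⟩
      exact hvS (h₁.eq_of_apply_eq u (hSG hu) v hv huv hvx ▸ hu)
    obtain ⟨Y, hvY, hYS, hle, hYk⟩ := hr₁.exists_cut (φ₁ v) (h₁.mapsTo hv) hvS₁
    refine ⟨φ₁ ⁻¹' Y, hvY, (hYS.preimage φ₁).mono_right (Set.subset_preimage_image φ₁ S),
      fun u hu huG ↦ ?_, (h₁.cutSize_preimage Y).trans_le hYk⟩
    rcases (hle _ hu (h₁.mapsTo huG)).lt_or_eq with hlt | heq
    · exact Prod.Lex.toLex_le_toLex.2 (.inl hlt)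
    · rw [h₁.eq_of_apply_eq u huG v hv
        (hr₁.injOn (h₁.mapsTo huG) (h₁.mapsTo hv) heq.symm) hvx]

theorem IsCutContraction.cutSize_image (h₁ : IsCutContraction G G₁ φ₁ x₁) {S : Set α}
    (hSG : S ⊆ V(G)) (hSx₁ : ∀ v ∈ S, φ₁ v ≠ x₁) : cutSize G₁ (φ₁ '' S) = cutSize G S := by
  rw [← h₁.cutSize_preimage]
  refine cutSize_congr (Set.ext fun v ↦ and_congr_left fun hv ↦ ⟨?_, fun hvS ↦ ⟨v, hvS, rfl⟩⟩)
  rintro ⟨u, hu, huv⟩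
  exact h₁.eq_of_apply_eq u (hSG hu) v hv huv (huv ▸ hSx₁ u hu) ▸ hu

end CutContractions

section RootedRanks

universe w

variable {α α' : Type w} {β β' : Type*} {G : Graph α β} {k : ℕ}

/-- `G` has an ordering in which every vertex can be separated from its predecessors by at most `k`
edges, and such an ordering can start with any vertex of degree at most `k`. The first vertex is
encoded by a set `S` with at most one element, so that both cases are treated at once. -/
def HasRootedRanks (G : Graph α β) (k : ℕ) : Prop :=
  ∀ S ⊆ V(G), S.Subsingleton → cutSize G S ≤ k →
    ∃ (ι : Type w) (_ : LinearOrder ι) (r : α → ι), IsAdmissibleRank G k S r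

/-- The large vertex, if any, comes first; it is separated from `S` by the cut of `S`. -/
theorem hasRootedRanks_of_subsingleton (h : {v ∈ V(G) | k < cutSize G {v}}.Subsingleton) :
    HasRootedRanks G k := by
  intro S _ _ hSk
  let _ : LinearOrder α := IsWellOrder.linearOrder WellOrderingRel
  refine ⟨Prop ×ₗ α, inferInstance, fun v ↦ toLex (cutSize G {v} ≤ k, v), ?_, fun v hv hvS ↦ ?_⟩
  · intro u _ v _ huv
    exact congrArg (fun p ↦ (ofLex p).2) huv
  by_cases hvk : cutSize G {v} ≤ k
  · exact ⟨{v}, rfl, Set.disjoint_singleton_left.2 hvS, by rintro _ rfl _; rfl, hvk⟩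
  · refine ⟨Sᶜ, hvS, disjoint_compl_left, fun u _ hu ↦ ?_, (cutSize_compl G S).trans_le hSk⟩
    by_cases huk : cutSize G {u} ≤ k
    · have hlt : (cutSize G {v} ≤ k) < (cutSize G {u} ≤ k) :=
        lt_of_le_not_ge (fun h ↦ absurd h hvk) fun h ↦ hvk (h huk)
      exact Prod.Lex.toLex_le_toLex.2 (.inl hlt)
    · rw [h ⟨hu, not_le.1 huk⟩ ⟨hv, not_le.1 hvk⟩]

theorem HasRootedRanks.of_injOn {H : Graph α' β'} {φ : α → α'} (hH : HasRootedRanks H k)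
    (hmaps : Set.MapsTo φ V(G) V(H)) (hinj : Set.InjOn φ V(G))
    (hcut : ∀ Y, cutSize G (φ ⁻¹' Y) = cutSize H Y) : HasRootedRanks G k := by
  intro S hSG hS hSk
  have hpre : ∀ v ∈ V(G), φ v ∈ φ '' S ↔ v ∈ S := fun v hv ↦ hinj.mem_image_iff hSG hv
  have hφS : cutSize H (φ '' S) = cutSize G S := by
    rw [← hcut]
    refine cutSize_congr (Set.ext fun v ↦ ?_)
    exact and_congr_left (hpre v)
  obtain ⟨ι, _, r, hr⟩ := hH (φ '' S) (hmaps.mono_left hSG).image_subset (hS.image φ)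
    (hφS.trans_le hSk)
  refine ⟨ι, inferInstance, r ∘ φ, hr.injOn.comp hinj hmaps, fun v hv hvS ↦ ?_⟩
  obtain ⟨Y, hvY, hYS, hle, hYk⟩ := hr.exists_cut (φ v) (hmaps hv) (mt (hpre v hv).1 hvS)
  exact ⟨φ ⁻¹' Y, hvY, (hYS.preimage φ).mono_right (Set.subset_preimage_image φ S),
    fun u hu huG ↦ hle (φ u) hu (hmaps huG), (hcut Y).trans_le hYk⟩

variable {α₁ α₂ : Type w} {β₁ β₂ : Type*} {G₁ : Graph α₁ β₁} {G₂ : Graph α₂ β₂} {φ₁ : α → α₁}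
  {φ₂ : α → α₂} {x₁ : α₁} {x₂ : α₂}

theorem IsCutContraction.exists_isAdmissibleRank (h₁ : IsCutContraction G G₁ φ₁ x₁)
    (h₂ : IsCutContraction G G₂ φ₂ x₂) (hφ : ∀ v ∈ V(G), φ₁ v = x₁ ↔ φ₂ v ≠ x₂)
    (hx₂ : x₂ ∈ V(G₂)) (hx₂k : cutSize G₂ {x₂} ≤ k) (H₁ : HasRootedRanks G₁ k)
    (H₂ : HasRootedRanks G₂ k) {S : Set α} (hSG : S ⊆ V(G)) (hS : S.Subsingleton)
    (hSk : cutSize G S ≤ k) (hSx₁ : ∀ v ∈ S, φ₁ v ≠ x₁) :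
    ∃ (ι : Type w) (_ : LinearOrder ι) (r : α → ι), IsAdmissibleRank G k S r := by
  obtain ⟨ι₁, _, r₁, hr₁⟩ := H₁ (φ₁ '' S) (h₁.mapsTo.mono_left hSG).image_subset (hS.image φ₁)
    ((h₁.cutSize_image hSG hSx₁).trans_le hSk)
  obtain ⟨ι₂, _, r₂, hr₂⟩ := H₂ {x₂} (Set.singleton_subset_iff.2 hx₂)
    Set.subsingleton_singleton hx₂k
  exact ⟨ι₁ ×ₗ ι₂, inferInstance, _, h₁.isAdmissibleRank_toLex h₂ hφ hr₁ hr₂ hSG hSx₁⟩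

theorem HasRootedRanks.of_isCutContraction (H₁ : HasRootedRanks G₁ k) (H₂ : HasRootedRanks G₂ k)
    (h₁ : IsCutContraction G G₁ φ₁ x₁) (h₂ : IsCutContraction G G₂ φ₂ x₂)
    (hφ : ∀ v ∈ V(G), φ₁ v = x₁ ↔ φ₂ v ≠ x₂) (hx₁ : x₁ ∈ V(G₁)) (hx₂ : x₂ ∈ V(G₂))
    (hx₁k : cutSize G₁ {x₁} ≤ k) (hx₂k : cutSize G₂ {x₂} ≤ k) : HasRootedRanks G k := by
  intro S hSG hS hSk
  by_cases hSx₁ : ∀ v ∈ S, φ₁ v ≠ x₁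
  · exact h₁.exists_isAdmissibleRank h₂ hφ hx₂ hx₂k H₁ H₂ hSG hS hSk hSx₁
  · push Not at hSx₁
    obtain ⟨v, hv, hvx⟩ := hSx₁
    have hφ' : ∀ v ∈ V(G), φ₂ v = x₂ ↔ φ₁ v ≠ x₁ := fun v hv ↦ (not_iff_comm.1 (hφ v hv).symm).symm
    refine h₂.exists_isAdmissibleRank h₁ hφ' hx₁ hx₁k H₂ H₁ hSG hS hSk fun u hu ↦ ?_
    rw [hS hu hv]
    exact (hφ v (hSG hv)).1 hvx

end RootedRanks

/-! ### Orderings of sums -/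

section Isomorphisms

variable {α α' β β' : Type*} {G : Graph α β} {H : Graph α' β'}

theorem loopless_of_iso (f : Iso G H) [H.Loopless] : G.Loopless :=
  ⟨fun e x h ↦ Loopless.not_isLoopAt _ _
    ((f.isLink_iff ⟨e, h.edge_mem⟩ ⟨x, h.vertex_mem⟩ ⟨x, h.vertex_mem⟩).1 h)⟩

theorem cutSize_preimage_of_vertexEquiv (f : Iso G H) {φ : α → α'}
    (hφ : ∀ v : V(G), φ v = f.vertexEquiv v) (Y : Set α') :
    cutSize G (φ ⁻¹' Y) = cutSize H Y := by
  refine cutSize_preimage φ (Subtype.val_injective.comp f.edgeEquiv.symm.injective) ?_ ?_ Y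
  · intro e a b h _
    refine ⟨f.edgeEquiv ⟨e, h.edge_mem⟩, by simp, ?_⟩
    rw [hφ ⟨a, h.left_mem⟩, hφ ⟨b, h.right_mem⟩]
    exact (f.isLink_iff ⟨e, h.edge_mem⟩ ⟨a, h.left_mem⟩ ⟨b, h.right_mem⟩).1 h
  · intro e a b h
    obtain ⟨a', ha'⟩ := f.vertexEquiv.surjective ⟨a, h.left_mem⟩
    obtain ⟨b', hb'⟩ := f.vertexEquiv.surjective ⟨b, h.right_mem⟩
    refine ⟨a', b', ?_, by rw [hφ, ha'], by rw [hφ, hb']⟩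
    rw [Function.comp_apply, f.isLink_iff, Equiv.apply_symm_apply, ha', hb']
    exact h

end Isomorphisms

theorem hasRootedRanks_of_iso.{w} {α α' : Type w} {β β' : Type*} {G : Graph α β}
    {H : Graph α' β'} {k : ℕ} (f : Iso G H) (hH : HasRootedRanks H k) :
    HasRootedRanks G k := by
  rcases V(G).eq_empty_or_nonempty with hG | ⟨v, hv⟩
  · exact hasRootedRanks_of_subsingleton (by simp [hG])
  have : Nonempty α' := ⟨f.vertexEquiv ⟨v, hv⟩⟩
  obtain ⟨φ, hφ⟩ : ∃ φ : α → α', ∀ v : V(G), φ v = f.vertexEquiv v :=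
    ⟨_, Subtype.val_injective.extend_apply (fun v ↦ (f.vertexEquiv v : α'))
      fun _ ↦ Classical.arbitrary α'⟩
  refine hH.of_injOn (φ := φ) (fun u hu ↦ ?_) (fun u hu v hv huv ↦ ?_)
    (cutSize_preimage_of_vertexEquiv f hφ)
  · rw [hφ ⟨u, hu⟩]
    exact Subtype.property _
  · rw [hφ ⟨u, hu⟩, hφ ⟨v, hv⟩] at huv
    exact congrArg Subtype.val (f.vertexEquiv.injective (Subtype.val_injective huv))

section DisjointUnion

variable {α₁ α₂ β₁ β₂ : Type*} {G₁ : Graph α₁ β₁} {G₂ : Graph α₂ β₂} {k : ℕ}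

theorem loopless_disjointUnion [G₁.Loopless] [G₂.Loopless] : (disjointUnion G₁ G₂).Loopless := by
  refine ⟨fun e x h ↦ ?_⟩
  cases h with
  | left h => exact h.ne rfl
  | right h => exact h.ne rfl

theorem cutSet_disjointUnion (Y : Set (α₁ ⊕ α₂)) : cutSet (disjointUnion G₁ G₂) Y =
    Sum.inl '' cutSet G₁ (Sum.inl ⁻¹' Y) ∪ Sum.inr '' cutSet G₂ (Sum.inr ⁻¹' Y) := by
  ext e
  constructor
  · rintro ⟨a, b, h | h, ha, hb⟩
    · exact .inl ⟨_, ⟨_, _, h, ha, hb⟩, rfl⟩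
    · exact .inr ⟨_, ⟨_, _, h, ha, hb⟩, rfl⟩
  · rintro (⟨e, ⟨a, b, h, ha, hb⟩, rfl⟩ | ⟨e, ⟨a, b, h, ha, hb⟩, rfl⟩)
    · exact ⟨_, _, .left h, ha, hb⟩
    · exact ⟨_, _, .right h, ha, hb⟩

theorem cutSize_disjointUnion (Y : Set (α₁ ⊕ α₂)) : cutSize (disjointUnion G₁ G₂) Y =
    cutSize G₁ (Sum.inl ⁻¹' Y) + cutSize G₂ (Sum.inr ⁻¹' Y) := by
  rw [cutSize, cutSet_disjointUnion, Set.encard_union_eq Set.disjoint_image_inl_image_inr,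
    Sum.inl_injective.encard_image, Sum.inr_injective.encard_image, cutSize, cutSize]

theorem IsAdmissibleRank.disjointUnion {ι₁ ι₂ : Type*} [LinearOrder ι₁] [LinearOrder ι₂]
    {S : Set (α₁ ⊕ α₂)} {r₁ : α₁ → ι₁} {r₂ : α₂ → ι₂}
    (hr₁ : IsAdmissibleRank G₁ k (Sum.inl ⁻¹' S) r₁)
    (hr₂ : IsAdmissibleRank G₂ k (Sum.inr ⁻¹' S) r₂) :
    IsAdmissibleRank (disjointUnion G₁ G₂) k S (fun v ↦ toLex (Sum.map r₁ r₂ v)) where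
  injOn := by
    rintro _ (⟨a, ha, rfl⟩ | ⟨a, ha, rfl⟩) _ (⟨b, hb, rfl⟩ | ⟨b, hb, rfl⟩) h
    · exact congrArg _ (hr₁.injOn ha hb (Sum.inl_injective h))
    · cases h
    · cases h
    · exact congrArg _ (hr₂.injOn ha hb (Sum.inr_injective h))
  exists_cut := by
    rintro _ (⟨v, hv, rfl⟩ | ⟨v, hv, rfl⟩) hvS
    · obtain ⟨Y, hvY, hYS, hle, hYk⟩ := hr₁.exists_cut v hv hvS
      refine ⟨Sum.inl '' Y, ⟨v, hvY, rfl⟩, Set.disjoint_image_left.2 hYS, ?_, ?_⟩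
      · rintro _ ⟨u, hu, rfl⟩ huG
        exact Sum.Lex.inl_le_inl_iff.2 (hle u hu (by simpa [Graph.disjointUnion] using huG))
      · simpa [cutSize_disjointUnion, Set.preimage_image_eq _ Sum.inl_injective] using hYk
    · obtain ⟨Y, hvY, hYS, hle, hYk⟩ := hr₂.exists_cut v hv hvS
      refine ⟨Sum.inr '' Y, ⟨v, hvY, rfl⟩, Set.disjoint_image_left.2 hYS, ?_, ?_⟩
      · rintro _ ⟨u, hu, rfl⟩ huG
        exact Sum.Lex.inr_le_inr_iff.2 (hle u hu (by simpa [Graph.disjointUnion] using huG))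
      · simpa [cutSize_disjointUnion, Set.preimage_image_eq _ Sum.inr_injective] using hYk

end DisjointUnion

theorem hasRootedRanks_disjointUnion.{w} {α₁ α₂ : Type w} {β₁ β₂ : Type*} {G₁ : Graph α₁ β₁}
    {G₂ : Graph α₂ β₂} {k : ℕ} (H₁ : HasRootedRanks G₁ k) (H₂ : HasRootedRanks G₂ k) :
    HasRootedRanks (disjointUnion G₁ G₂) k := by
  intro S hSG hS hSk
  rw [cutSize_disjointUnion] at hSk
  obtain ⟨ι₁, _, r₁, hr₁⟩ := H₁ (Sum.inl ⁻¹' S)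
    (fun v hv ↦ by simpa [disjointUnion] using hSG hv) (hS.preimage Sum.inl_injective)
    (le_self_add.trans hSk)
  obtain ⟨ι₂, _, r₂, hr₂⟩ := H₂ (Sum.inr ⁻¹' S)
    (fun v hv ↦ by simpa [disjointUnion] using hSG hv) (hS.preimage Sum.inr_injective)
    (le_add_self.trans hSk)
  exact ⟨ι₁ ⊕ₗ ι₂, inferInstance, _, hr₁.disjointUnion hr₂⟩

section EdgeSum

variable {α₁ α₂ β₁ β₂ : Type*} {G₁ : Graph α₁ β₁} {G₂ : Graph α₂ β₂} {x₁ : α₁} {x₂ : α₂}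
  {σ : G₁.incidenceSet x₁ ≃ G₂.incidenceSet x₂}

theorem loopless_edgeSum [G₁.Loopless] [G₂.Loopless] : (edgeSum G₁ G₂ x₁ x₂ σ).Loopless := by
  refine ⟨fun e x h ↦ ?_⟩
  cases h with
  | left h => exact h.ne rfl
  | right h => exact h.ne rfl

theorem cutSize_edgeSum_preimage_left [G₁.Loopless] [G₂.Loopless] (Y : Set α₁) :
    cutSize (edgeSum G₁ G₂ x₁ x₂ σ) (Sum.elim id (fun _ ↦ x₁) ⁻¹' Y) = cutSize G₁ Y := by
  refine cutSize_preimage _ (Sum.inl_injective.comp Subtype.val_injective) ?_ ?_ Y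
  · rintro e a b h hab
    cases h with
    | left h _ _ => exact ⟨⟨_, h.edge_mem⟩, rfl, h⟩
    | right _ _ _ => exact absurd rfl hab
    | lift _ h _ _ _ => exact ⟨⟨_, h.edge_mem⟩, rfl, h.symm⟩
    | lift' _ h _ _ _ => exact ⟨⟨_, h.edge_mem⟩, rfl, h⟩
  · rintro ⟨e, _⟩ a b h
    by_cases hax : a = x₁
    · subst hax
      obtain ⟨d, hd⟩ := (σ ⟨e, b, h⟩).2
      exact ⟨.inr d, .inl b, .lift' _ h hd h.ne.symm hd.ne.symm, rfl, rfl⟩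
    by_cases hbx : b = x₁
    · subst hbx
      obtain ⟨d, hd⟩ := (σ ⟨e, a, h.symm⟩).2
      exact ⟨.inl a, .inr d, .lift _ h.symm hd h.ne hd.ne.symm, rfl, rfl⟩
    · exact ⟨.inl a, .inl b, .left h hax hbx, rfl, rfl⟩

open Classical in
/-- The edge of an edge sum that comes from the edge `e` of the right-hand graph: an edge at `x₂` is
lifted together with its partner under `σ`, after which the lifted edge is named. -/
noncomputable def edgeSumRightEdge (σ : G₁.incidenceSet x₁ ≃ G₂.incidenceSet x₂) (e : β₂) :
    β₁ ⊕ β₂ :=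
  if h : e ∈ G₂.incidenceSet x₂ then .inl (σ.symm ⟨e, h⟩) else .inr e

theorem edgeSumRightEdge_apply (e : G₁.incidenceSet x₁) :
    edgeSumRightEdge σ (σ e) = .inl e.1 := by
  rw [edgeSumRightEdge, dif_pos (σ e).2, Subtype.coe_eta, Equiv.symm_apply_apply]

theorem edgeSumRightEdge_of_isLink {e : β₂} {a b : α₂} (h : G₂.IsLink e a b) (ha : a ≠ x₂)
    (hb : b ≠ x₂) : edgeSumRightEdge σ e = .inr e :=
  dif_neg fun he ↦ (Inc.eq_or_eq_of_isLink he h).elim ha.symm hb.symm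

theorem edgeSumRightEdge_injective : Function.Injective (edgeSumRightEdge σ) := by
  intro e f h
  unfold edgeSumRightEdge at h
  split_ifs at h with he hf hf
  · exact congrArg Subtype.val (σ.symm.injective (Subtype.ext (Sum.inl_injective h)))
  · exact Sum.inr_injective h

theorem cutSize_edgeSum_preimage_right [G₁.Loopless] [G₂.Loopless] (Y : Set α₂) :
    cutSize (edgeSum G₁ G₂ x₁ x₂ σ) (Sum.elim (fun _ ↦ x₂) id ⁻¹' Y) = cutSize G₂ Y := by
  refine cutSize_preimage _
    ((edgeSumRightEdge_injective (σ := σ)).comp Subtype.val_injective) ?_ ?_ Y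
  · rintro e a b h hab
    cases h with
    | left _ _ _ => exact absurd rfl hab
    | right h hax hbx => exact ⟨⟨_, h.edge_mem⟩, edgeSumRightEdge_of_isLink h hax hbx, h⟩
    | lift _ _ h _ _ => exact ⟨⟨_, h.edge_mem⟩, edgeSumRightEdge_apply _, h⟩
    | lift' _ _ h _ _ => exact ⟨⟨_, h.edge_mem⟩, edgeSumRightEdge_apply _, h.symm⟩
  · rintro ⟨e, _⟩ a b h
    rw [Function.comp_apply]
    by_cases hex : e ∈ G₂.incidenceSet x₂
    · obtain ⟨f, hf⟩ := σ.surjective ⟨e, hex⟩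
      obtain rfl : (σ f : β₂) = e := congrArg Subtype.val hf
      rw [edgeSumRightEdge_apply]
      obtain ⟨d, hd⟩ := f.2
      rcases Inc.eq_or_eq_of_isLink hex h with rfl | rfl
      · exact ⟨.inl d, .inr b, .lift f.2 hd h hd.ne.symm h.ne.symm, rfl, rfl⟩
      · exact ⟨.inr a, .inl d, .lift' f.2 hd h.symm hd.ne.symm h.ne, rfl, rfl⟩
    · have ha : a ≠ x₂ := fun ha ↦ hex (ha ▸ h.inc_left)
      have hb : b ≠ x₂ := fun hb ↦ hex (hb ▸ h.inc_right)
      rw [edgeSumRightEdge_of_isLink h ha hb]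
      exact ⟨.inr a, .inr b, .right h ha hb, rfl, rfl⟩

theorem isCutContraction_edgeSum_left [G₁.Loopless] [G₂.Loopless] (hx₁ : x₁ ∈ V(G₁)) :
    IsCutContraction (edgeSum G₁ G₂ x₁ x₂ σ) G₁ (Sum.elim id fun _ ↦ x₁) x₁ where
  mapsTo := by
    rintro _ (⟨a, ha, rfl⟩ | ⟨b, -, rfl⟩)
    exacts [ha.1, hx₁]
  eq_of_apply_eq := by
    rintro (a | b) - (c | d) - huv hv
    exacts [congrArg Sum.inl huv, absurd rfl hv, absurd huv.symm hv, absurd rfl hv]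
  cutSize_preimage := cutSize_edgeSum_preimage_left

theorem isCutContraction_edgeSum_right [G₁.Loopless] [G₂.Loopless] (hx₂ : x₂ ∈ V(G₂)) :
    IsCutContraction (edgeSum G₁ G₂ x₁ x₂ σ) G₂ (Sum.elim (fun _ ↦ x₂) id) x₂ where
  mapsTo := by
    rintro _ (⟨a, -, rfl⟩ | ⟨b, hb, rfl⟩)
    exacts [hx₂, hb.1]
  eq_of_apply_eq := by
    rintro (a | b) - (c | d) - huv hv
    exacts [absurd rfl hv, absurd huv.symm hv, absurd rfl hv, congrArg Sum.inr huv]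
  cutSize_preimage := cutSize_edgeSum_preimage_right

end EdgeSum

section Closure

universe w z

variable {α α₁ α₂ : Type w} {β β₁ β₂ : Type z} {G : Graph α β} {G₁ : Graph α₁ β₁}
  {G₂ : Graph α₂ β₂} {k : ℕ}

theorem hasRootedRanks_edgeSum [G₁.Loopless] [G₂.Loopless] {x₁ : α₁} {x₂ : α₂}
    {σ : G₁.incidenceSet x₁ ≃ G₂.incidenceSet x₂} (hx₁ : x₁ ∈ V(G₁)) (hx₂ : x₂ ∈ V(G₂))
    (hx₁k : G₁.edgeDegree x₁ ≤ k) (hx₂k : G₂.edgeDegree x₂ ≤ k) (H₁ : HasRootedRanks G₁ k)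
    (H₂ : HasRootedRanks G₂ k) : HasRootedRanks (edgeSum G₁ G₂ x₁ x₂ σ) k := by
  refine H₁.of_isCutContraction H₂ (isCutContraction_edgeSum_left hx₁)
    (isCutContraction_edgeSum_right hx₂) ?_ hx₁ hx₂
    ((cutSize_singleton_le_edgeDegree G₁ x₁).trans hx₁k)
    ((cutSize_singleton_le_edgeDegree G₂ x₂).trans hx₂k)
  rintro _ (⟨a, ha, rfl⟩ | ⟨b, hb, rfl⟩)
  · exact iff_of_false ha.2 fun h ↦ h rfl
  · exact iff_of_true rfl hb.2

theorem loopless_and_hasRootedRanks_of_isEdgeSumLE [G₁.Loopless] [G₂.Loopless]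
    (h : IsEdgeSumLE k G G₁ G₂) (H₁ : HasRootedRanks G₁ k) (H₂ : HasRootedRanks G₂ k) :
    G.Loopless ∧ HasRootedRanks G k := by
  rcases h with ⟨⟨f⟩⟩ | ⟨k', -, hk', x₁, hx₁, x₂, hx₂, hdeg₁, hdeg₂, σ, ⟨f⟩⟩
  · have := loopless_disjointUnion (G₁ := G₁) (G₂ := G₂)
    exact ⟨loopless_of_iso f, hasRootedRanks_of_iso f (hasRootedRanks_disjointUnion H₁ H₂)⟩
  · have hk : (k' : ℕ∞) ≤ k := Nat.cast_le.2 hk'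
    have := loopless_edgeSum (σ := σ)
    exact ⟨loopless_of_iso f, hasRootedRanks_of_iso f (hasRootedRanks_edgeSum hx₁ hx₂
      (hdeg₁.trans_le hk) (hdeg₂.trans_le hk) H₁ H₂)⟩

theorem loopless_and_hasRootedRanks_of_edgeSumClosure
    (h : EdgeSumClosure (AlmostBoundedEdgeDegree k) k G) : G.Loopless ∧ HasRootedRanks G k := by
  induction h with
  | base h =>
    refine ⟨h.1.loopless, hasRootedRanks_of_subsingleton (h.2.anti fun v hv ↦ ⟨hv.1, ?_⟩)⟩
    exact hv.2.trans_le (cutSize_singleton_le_edgeDegree _ v)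
  | sum _ _ _ _ h ih₁ ih₂ =>
    have := ih₁.1
    have := ih₂.1
    exact loopless_and_hasRootedRanks_of_isEdgeSumLE h ih₁.2 ih₂.2

theorem edgeAdmissibility_le_of_edgeSumClosure (hG : V(G).Finite)
    (h : EdgeSumClosure (AlmostBoundedEdgeDegree k) k G) : G.edgeAdmissibility ≤ k := by
  obtain ⟨ι, _, r, hr⟩ := (loopless_and_hasRootedRanks_of_edgeSumClosure h).2 ∅
    (Set.empty_subset _) Set.subsingleton_empty (by simp only [cutSize_empty, zero_le])
  exact edgeAdmissibility_le_of_isAdmissibleRank hG hr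

end Closure

/-! ### Contractions -/

section Contract

variable {α α' β : Type*} {G : Graph α β} {A Y : Set α} {a b t : α} {e : β}

/-- The graph obtained from `G` by identifying vertices with the same image under `q` and deleting
the loops that arise. -/
def contract (G : Graph α β) (q : α → α') : Graph α' β :=
  (G.map q).deleteEdges {e | ∃ x, (G.map q).IsLoopAt e x}

theorem vertexSet_contract (G : Graph α β) (q : α → α') : V(contract G q) = q '' V(G) := rfl

theorem isLink_contract {q : α → α'} {x y : α'} :
    (contract G q).IsLink e x y ↔ x ≠ y ∧ ∃ a b, G.IsLink e a b ∧ q a = x ∧ q b = y := by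
  have hmap : (contract G q).IsLink e x y ↔
      (G.map q).IsLink e x y ∧ ∀ z, ¬(G.map q).IsLoopAt e z := by
    simp only [contract, deleteEdges_isLink, Set.mem_ofPred_eq, not_exists]
  rw [hmap, and_comm]
  refine and_congr_left fun h ↦ ⟨fun hloop hxy ↦ hloop x ?_, fun hxy z hz ↦ hxy ?_⟩
  · subst hxy
    exact h
  · rcases h.eq_and_eq_or_eq_and_eq hz with ⟨rfl, rfl⟩ | ⟨rfl, rfl⟩ <;> rfl

instance loopless_contract (q : α → α') : (contract G q).Loopless :=
  ⟨fun _ _ h ↦ (isLink_contract.1 h).1 rfl⟩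

theorem isFiniteLoopless_contract (hG : G.IsFiniteLoopless) (q : α → α') :
    (contract G q).IsFiniteLoopless where
  finite_vertexSet := hG.finite_vertexSet.image q
  finite_edgeSet := hG.finite_edgeSet.subset fun _ h ↦ h.1
  loopless := loopless_contract q

theorem cutSet_contract (q : α → α') (Y : Set α') :
    cutSet (contract G q) Y = cutSet G (q ⁻¹' Y) := by
  ext e
  constructor
  · rintro ⟨x, y, h, hx, hy⟩
    obtain ⟨-, a, b, hab, rfl, rfl⟩ := isLink_contract.1 h
    exact ⟨a, b, hab, hx, hy⟩
  · rintro ⟨a, b, h, ha, hb⟩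
    have hab : q a ≠ q b := fun hab ↦ hb (show q b ∈ Y from hab ▸ ha)
    exact ⟨q a, q b, isLink_contract.2 ⟨hab, a, b, h, rfl, rfl⟩, ha, hb⟩

open Classical in
/-- The map that sends all elements of `A` to `t` and fixes the others. Contracting a graph along it
shrinks `A` to the single vertex `t`. -/
noncomputable def collapse (A : Set α) (t a : α) : α := if a ∈ A then t else a

theorem collapse_of_mem (ha : a ∈ A) : collapse A t a = t := if_pos ha

theorem collapse_of_notMem (ha : a ∉ A) : collapse A t a = a := if_neg ha

theorem collapse_eq_iff_of_ne (hb : b ≠ t) : collapse A t a = b ↔ a ∉ A ∧ a = b := by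
  by_cases ha : a ∈ A
  · simp [collapse_of_mem ha, ha, hb.symm]
  · simp [collapse_of_notMem ha, ha]

theorem preimage_collapse_of_mem (ht : t ∈ Y) : collapse A t ⁻¹' Y = Y ∪ A := by
  ext a
  by_cases ha : a ∈ A <;> simp [collapse, ha, ht]

theorem preimage_collapse_of_notMem (ht : t ∉ Y) : collapse A t ⁻¹' Y = Y \ A := by
  ext a
  by_cases ha : a ∈ A <;> simp [collapse, ha, ht]

theorem preimage_collapse_singleton (ht : t ∈ A) : collapse A t ⁻¹' {t} = A := by
  rw [preimage_collapse_of_mem (Set.mem_singleton t), Set.singleton_union, Set.insert_eq_of_mem ht]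

theorem collapse_eq_iff (ht : t ∈ A) : collapse A t a = t ↔ a ∈ A :=
  Set.ext_iff.1 (preimage_collapse_singleton ht) a

theorem mem_vertexSet_contract_collapse (ha : a ≠ t) :
    a ∈ V(contract G (collapse A t)) ↔ a ∈ V(G) ∧ a ∉ A := by
  simp only [vertexSet_contract, Set.mem_image, collapse_eq_iff_of_ne ha]
  exact ⟨fun ⟨b, hb, hbA, hba⟩ ↦ hba ▸ ⟨hb, hbA⟩, fun h ↦ ⟨a, h.1, h.2, rfl⟩⟩

theorem vertexSet_contract_collapse_sdiff_singleton (ht : t ∈ A) :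
    V(contract G (collapse A t)) \ {t} = V(G) \ A := by
  ext a
  by_cases ha : a = t
  · simp [ha, ht]
  · simp [mem_vertexSet_contract_collapse ha, ha]

theorem vertexSet_contract_collapse_ssubset {t' : α} (ht : t ∈ V(G)) (ht' : t' ∈ V(G))
    (htA : t' ∈ A) (hne : t' ≠ t) : V(contract G (collapse A t)) ⊂ V(G) := by
  refine Set.ssubset_iff_exists.2 ⟨?_, t', ht', fun h ↦ ?_⟩
  · rintro _ ⟨a, ha, rfl⟩
    by_cases haA : a ∈ A
    · rwa [collapse_of_mem haA]
    · rwa [collapse_of_notMem haA]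
  · exact ((mem_vertexSet_contract_collapse hne).1 h).2 htA

theorem isLink_contract_collapse [G.Loopless] (ha : a ≠ t) (hb : b ≠ t) :
    (contract G (collapse A t)).IsLink e a b ↔ G.IsLink e a b ∧ a ∉ A ∧ b ∉ A := by
  simp only [isLink_contract, collapse_eq_iff_of_ne ha, collapse_eq_iff_of_ne hb]
  constructor
  · rintro ⟨-, _, _, h, ⟨haA, rfl⟩, hbA, rfl⟩
    exact ⟨h, haA, hbA⟩
  · rintro ⟨h, haA, hbA⟩
    exact ⟨h.ne, a, b, h, ⟨haA, rfl⟩, hbA, rfl⟩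

theorem isLink_contract_collapse_left (ht : t ∈ A) :
    (contract G (collapse A t)).IsLink e t b ↔ b ∉ A ∧ ∃ a ∈ A, G.IsLink e a b := by
  rw [isLink_contract]
  constructor
  · rintro ⟨hb, a, c, h, ha, hc⟩
    obtain ⟨hbA, rfl⟩ := (collapse_eq_iff_of_ne hb.symm).1 hc
    exact ⟨hbA, a, (collapse_eq_iff ht).1 ha, h⟩
  · rintro ⟨hb, a, ha, h⟩
    exact ⟨fun h ↦ hb (h ▸ ht), a, b, h, collapse_of_mem ha, collapse_of_notMem hb⟩

theorem incidenceSet_contract_collapse (ht : t ∈ A) :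
    (contract G (collapse A t)).incidenceSet t = cutSet G A := by
  rw [← cutSet_singleton, cutSet_contract, preimage_collapse_singleton ht]

theorem edgeDegree_contract_collapse (ht : t ∈ A) :
    (contract G (collapse A t)).edgeDegree t = cutSize G A := by
  rw [edgeDegree, incidenceSet_contract_collapse ht, cutSize]

theorem edgeDegree_contract_collapse_of_notMem (ha : a ∉ A) (ht : t ∈ A) :
    (contract G (collapse A t)).edgeDegree a = cutSize G {a} := by
  have hta : t ∉ ({a} : Set α) := fun h ↦ ha (Set.mem_singleton_iff.1 h ▸ ht)
  rw [edgeDegree_eq_cutSize_singleton, cutSize, cutSet_contract, preimage_collapse_of_notMem hta,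
    (Set.disjoint_singleton_left.2 ha).sdiff_eq_left, cutSize]

end Contract

/-! ### Splitting a graph along an edge cut -/

section Split

variable {α β : Type*} {G : Graph α β} {A : Set α} {a b s t : α} {e : β} {k : ℕ}

theorem nonempty_iso_of_injective {α' β' : Type*} {H : Graph α' β'} {f : α → α'} {g : β → β'}
    (hf : f.Injective) (hg : g.Injective) (hV : V(H) = f '' V(G))
    (exists_of_isLink : ∀ e x y, H.IsLink e x y →
      ∃ e' a b, G.IsLink e' a b ∧ g e' = e ∧ f a = x ∧ f b = y)
    (isLink_of_isLink : ∀ e a b, G.IsLink e a b → H.IsLink (g e) (f a) (f b)) :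
    Nonempty (Iso G H) := by
  have hE : E(H) = g '' E(G) := by
    refine Set.Subset.antisymm (fun e he ↦ ?_) (Set.image_subset_iff.2 fun e he ↦ ?_)
    · obtain ⟨x, y, h⟩ := exists_isLink_of_mem_edgeSet he
      obtain ⟨e', a, b, h', rfl, -⟩ := exists_of_isLink e x y h
      exact ⟨e', h'.edge_mem, rfl⟩
    · obtain ⟨a, b, h⟩ := exists_isLink_of_mem_edgeSet he
      exact (isLink_of_isLink e a b h).edge_mem
  refine ⟨(Equiv.Set.image f _ hf).trans (Equiv.setCongr hV.symm),
    (Equiv.Set.image g _ hg).trans (Equiv.setCongr hE.symm),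
    fun e a b ↦ ⟨isLink_of_isLink e a b, fun h ↦ ?_⟩⟩
  obtain ⟨e', a', b', h', he, ha, hb⟩ := exists_of_isLink _ _ _ h
  rwa [hg he, hf ha, hf hb] at h'

open Classical in
/-- The map that sorts the elements of a type into those inside `A` and those outside. It is used to
name the vertices and the edges of a graph as those of a sum of two graphs. -/
noncomputable def sideMap {γ : Type*} (A : Set γ) (a : γ) : γ ⊕ γ :=
  if a ∈ A then .inl a else .inr a

theorem sideMap_of_mem {γ : Type*} {A : Set γ} {a : γ} (h : a ∈ A) : sideMap A a = .inl a :=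
  if_pos h

theorem sideMap_of_notMem {γ : Type*} {A : Set γ} {a : γ} (h : a ∉ A) : sideMap A a = .inr a :=
  if_neg h

theorem sideMap_injective {γ : Type*} (A : Set γ) : (sideMap A).Injective :=
  Function.LeftInverse.injective (g := Sum.elim id id) fun a ↦ by
    by_cases ha : a ∈ A <;> simp [sideMap, ha]

theorem image_sideMap {γ : Type*} (A B : Set γ) :
    sideMap A '' B = Sum.inl '' (B \ Aᶜ) ∪ Sum.inr '' (B \ A) := by
  rw [Set.sdiff_compl]
  conv_lhs => rw [← Set.inter_union_sdiff B A, Set.image_union]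
  exact congrArg₂ _ (Set.image_congr fun a ha ↦ sideMap_of_mem ha.2)
    (Set.image_congr fun a ha ↦ sideMap_of_notMem ha.2)

/-- The edges of `G` with at least one end in `A`. -/
def touching (G : Graph α β) (A : Set α) : Set β := {e | ∃ a ∈ A, G.Inc e a}

theorem mem_touching_iff (h : G.IsLink e a b) : e ∈ touching G A ↔ a ∈ A ∨ b ∈ A := by
  constructor
  · rintro ⟨c, hc, hi⟩
    rcases hi.eq_or_eq_of_isLink h with rfl | rfl
    exacts [.inl hc, .inr hc]
  · rintro (ha | hb)
    exacts [⟨a, ha, h.inc_left⟩, ⟨b, hb, h.inc_right⟩]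

theorem sideMap_touching_of_mem (h : G.IsLink e a b) (ha : a ∈ A) :
    sideMap (touching G A) e = .inl e :=
  sideMap_of_mem ((mem_touching_iff h).2 (.inl ha))

theorem sideMap_touching_of_notMem (h : G.IsLink e a b) (ha : a ∉ A) (hb : b ∉ A) :
    sideMap (touching G A) e = .inr e :=
  sideMap_of_notMem fun he ↦ ((mem_touching_iff h).1 he).elim ha hb

theorem nonempty_iso_disjointUnion_of_cutSize_eq_zero (hA : cutSize G A = 0) :
    Nonempty (Iso G (disjointUnion (G.deleteVerts Aᶜ) (G.deleteVerts A))) := by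
  have hcut : ∀ {e a b}, G.IsLink e a b → (a ∈ A ↔ b ∈ A) := fun h ↦ by
    by_contra hn
    exact (Set.encard_eq_zero.1 hA).subset ((mem_cutSet_iff h).2 hn)
  refine nonempty_iso_of_injective (sideMap_injective A) (sideMap_injective (touching G A))
    (image_sideMap A V(G)).symm ?_ fun e a b h ↦ ?_
  · rintro _ _ _ (⟨h⟩ | ⟨h⟩)
    · rw [deleteVerts_isLink, Set.notMem_compl_iff, Set.notMem_compl_iff] at h
      exact ⟨_, _, _, h.1, sideMap_touching_of_mem h.1 h.2.1, sideMap_of_mem h.2.1,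
        sideMap_of_mem h.2.2⟩
    · rw [deleteVerts_isLink] at h
      exact ⟨_, _, _, h.1, sideMap_touching_of_notMem h.1 h.2.1 h.2.2, sideMap_of_notMem h.2.1,
        sideMap_of_notMem h.2.2⟩
  · by_cases ha : a ∈ A
    · have hb := (hcut h).1 ha
      rw [sideMap_touching_of_mem h ha, sideMap_of_mem ha, sideMap_of_mem hb]
      exact .left ((deleteVerts_isLink _ _).2 ⟨h, not_not.2 ha, not_not.2 hb⟩)
    · have hb := mt (hcut h).2 ha
      rw [sideMap_touching_of_notMem h ha hb, sideMap_of_notMem ha, sideMap_of_notMem hb]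
      exact .right ((deleteVerts_isLink _ _).2 ⟨h, ha, hb⟩)

theorem isLink_contract_collapse_and_iff (hs : s ∈ A) (ht : t ∉ A) :
    (contract G (collapse Aᶜ t)).IsLink e t a ∧ (contract G (collapse A s)).IsLink e s b ↔
      G.IsLink e a b ∧ a ∈ A ∧ b ∉ A := by
  rw [isLink_contract_collapse_left (A := Aᶜ) ht, isLink_contract_collapse_left hs,
    Set.notMem_compl_iff]
  constructor
  · rintro ⟨⟨ha, c, hc, hca⟩, hb, d, hd, hdb⟩
    rcases hca.left_eq_or_eq hdb with rfl | rfl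
    exacts [absurd hd hc, ⟨hca.symm, ha, hb⟩]
  · rintro ⟨h, ha, hb⟩
    exact ⟨⟨ha, b, hb, h.symm⟩, hb, a, ha, h⟩

variable {σ : (contract G (collapse Aᶜ t)).incidenceSet t ≃
  (contract G (collapse A s)).incidenceSet s}

theorem exists_isLink_of_isLink_edgeSum [G.Loopless] (hs : s ∈ A) (ht : t ∉ A)
    (hσ : ∀ e, (σ e : β) = e) {f : β ⊕ β} {x y : α ⊕ α}
    (h : (edgeSum (contract G (collapse Aᶜ t)) (contract G (collapse A s)) t s σ).IsLink f x y) :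
    ∃ e a b, G.IsLink e a b ∧ sideMap (touching G A) e = f ∧ sideMap A a = x ∧
      sideMap A b = y := by
  cases h with
  | left h ha hb =>
    rw [isLink_contract_collapse ha hb, Set.notMem_compl_iff, Set.notMem_compl_iff] at h
    exact ⟨_, _, _, h.1, sideMap_touching_of_mem h.1 h.2.1, sideMap_of_mem h.2.1,
      sideMap_of_mem h.2.2⟩
  | right h ha hb =>
    rw [isLink_contract_collapse ha hb] at h
    exact ⟨_, _, _, h.1, sideMap_touching_of_notMem h.1 h.2.1 h.2.2, sideMap_of_notMem h.2.1,
      sideMap_of_notMem h.2.2⟩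
  | lift he h₁ h₂ _ _ =>
    rw [hσ] at h₂
    obtain ⟨h, ha, hb⟩ := (isLink_contract_collapse_and_iff hs ht).1 ⟨h₁, h₂⟩
    exact ⟨_, _, _, h, sideMap_touching_of_mem h ha, sideMap_of_mem ha, sideMap_of_notMem hb⟩
  | lift' he h₁ h₂ _ _ =>
    rw [hσ] at h₂
    obtain ⟨h, ha, hb⟩ := (isLink_contract_collapse_and_iff hs ht).1 ⟨h₁, h₂⟩
    exact ⟨_, _, _, h.symm, sideMap_touching_of_mem h ha, sideMap_of_notMem hb, sideMap_of_mem ha⟩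

theorem isLink_edgeSum_of_mem_cut (hs : s ∈ A) (ht : t ∉ A) (hσ : ∀ e, (σ e : β) = e)
    (h : G.IsLink e a b) (ha : a ∈ A) (hb : b ∉ A) :
    (edgeSum (contract G (collapse Aᶜ t)) (contract G (collapse A s)) t s σ).IsLink
      (.inl e) (.inl a) (.inr b) := by
  obtain ⟨h₁, h₂⟩ := (isLink_contract_collapse_and_iff hs ht).2 ⟨h, ha, hb⟩
  exact .lift ⟨a, h₁⟩ h₁ (by rwa [hσ]) (ne_of_mem_of_not_mem ha ht)
    (ne_of_mem_of_not_mem hs hb).symm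

theorem isLink_edgeSum_sideMap [G.Loopless] (hs : s ∈ A) (ht : t ∉ A) (hσ : ∀ e, (σ e : β) = e)
    (h : G.IsLink e a b) :
    (edgeSum (contract G (collapse Aᶜ t)) (contract G (collapse A s)) t s σ).IsLink
      (sideMap (touching G A) e) (sideMap A a) (sideMap A b) := by
  have hne_t : ∀ {c}, c ∈ A → c ≠ t := fun hc ↦ ne_of_mem_of_not_mem hc ht
  have hne_s : ∀ {c}, c ∉ A → c ≠ s := fun hc ↦ (ne_of_mem_of_not_mem hs hc).symm
  by_cases ha : a ∈ A <;> by_cases hb : b ∈ A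
  · rw [sideMap_touching_of_mem h ha, sideMap_of_mem ha, sideMap_of_mem hb]
    exact .left ((isLink_contract_collapse (hne_t ha) (hne_t hb)).2
      ⟨h, not_not.2 ha, not_not.2 hb⟩) (hne_t ha) (hne_t hb)
  · rw [sideMap_touching_of_mem h ha, sideMap_of_mem ha, sideMap_of_notMem hb]
    exact isLink_edgeSum_of_mem_cut hs ht hσ h ha hb
  · rw [sideMap_touching_of_mem h.symm hb, sideMap_of_notMem ha, sideMap_of_mem hb]
    exact (isLink_edgeSum_of_mem_cut hs ht hσ h.symm hb ha).symm
  · rw [sideMap_touching_of_notMem h ha hb, sideMap_of_notMem ha, sideMap_of_notMem hb]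
    exact .right ((isLink_contract_collapse (hne_s ha) (hne_s hb)).2 ⟨h, ha, hb⟩)
      (hne_s ha) (hne_s hb)

theorem isEdgeSum_contract_collapse [G.Loopless] (hs : s ∈ A) (ht : t ∉ A) (hsG : s ∈ V(G))
    (htG : t ∈ V(G)) (hk : cutSize G A = k) :
    IsEdgeSum k G (contract G (collapse Aᶜ t)) (contract G (collapse A s)) := by
  have hinc : (contract G (collapse Aᶜ t)).incidenceSet t =
      (contract G (collapse A s)).incidenceSet s := by
    rw [incidenceSet_contract_collapse (A := Aᶜ) ht, incidenceSet_contract_collapse hs,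
      cutSet_compl]
  refine ⟨t, ⟨t, htG, collapse_of_mem ht⟩, s, ⟨s, hsG, collapse_of_mem hs⟩, ?_, ?_,
    Equiv.setCongr hinc, ?_⟩
  · rw [edgeDegree_contract_collapse (A := Aᶜ) ht, cutSize_compl, hk]
  · rw [edgeDegree_contract_collapse hs, hk]
  refine nonempty_iso_of_injective (sideMap_injective A) (sideMap_injective (touching G A)) ?_
    (fun _ _ _ ↦ exists_isLink_of_isLink_edgeSum hs ht fun _ ↦ rfl)
    (fun _ _ _ ↦ isLink_edgeSum_sideMap hs ht fun _ ↦ rfl)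
  rw [image_sideMap, ← vertexSet_contract_collapse_sdiff_singleton hs,
    ← vertexSet_contract_collapse_sdiff_singleton (A := Aᶜ) ht]
  rfl

end Split

/-! ### Decomposing admissible graphs -/

section Decomposition

variable {α β ι : Type*} {G : Graph α β} {X Y : Set α} {s t : α} {k : ℕ}

theorem isFiniteLoopless_anti {H : Graph α β} (hG : G.IsFiniteLoopless) (h : H ≤ G) :
    H.IsFiniteLoopless where
  finite_vertexSet := hG.finite_vertexSet.subset h.vertexSet_mono
  finite_edgeSet := hG.finite_edgeSet.subset h.edgeSet_mono
  loopless := have := hG.loopless; Loopless.anti h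

/-- The cut of `X` is a smallest cut that separates `s` from the complement of `X`. -/
structure IsTight (G : Graph α β) (s : α) (X : Set α) : Prop where
  mem : s ∈ X
  cutSize_le : ∀ Z ⊆ X, s ∈ Z → cutSize G X ≤ cutSize G Z

theorem IsTight.cutSize_union_le (hX : IsTight G s X) (hfin : cutSize G X ≠ ⊤) (hs : s ∈ Y) :
    cutSize G (Y ∪ X) ≤ cutSize G Y := by
  refine (ENat.add_le_add_iff_right hfin).1 (le_trans ?_ (cutSize_union_add_cutSize_inter_le G Y X))
  gcongr
  exact hX.cutSize_le (Y ∩ X) Set.inter_subset_right ⟨hs, hX.mem⟩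

theorem IsTight.cutSize_sdiff_le (hX : IsTight G s X) (hfin : cutSize G X ≠ ⊤) (hs : s ∉ Y) :
    cutSize G (Y \ X) ≤ cutSize G Y := by
  refine (ENat.add_le_add_iff_right hfin).1 (le_trans ?_ (cutSize_sdiff_add_cutSize_sdiff_le G Y X))
  gcongr
  exact hX.cutSize_le (X \ Y) Set.sdiff_subset ⟨hX.mem, hs⟩

theorem IsTight.cutSize_contract_le (hX : IsTight G s X) (hfin : cutSize G X ≠ ⊤) (Y : Set α) :
    cutSize (contract G (collapse X s)) Y ≤ cutSize G Y := by
  rw [cutSize, cutSet_contract]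
  by_cases hs : s ∈ Y
  · rw [preimage_collapse_of_mem hs]
    exact hX.cutSize_union_le hfin hs
  · rw [preimage_collapse_of_notMem hs]
    exact hX.cutSize_sdiff_le hfin hs

/-- A cut of size at most `k` between two vertices `s` and `t` of degree more than `k` along which a
graph is decomposed: on the side `X` of `s` there is no other large vertex, and contracting `X` to
`s` does not enlarge cuts. -/
structure IsSplittingCut (G : Graph α β) (k : ℕ) (s t : α) (X : Set α) : Prop where
  isTight : IsTight G s X
  notMem : t ∉ X
  cutSize_le : cutSize G X ≤ k
  left_mem : s ∈ V(G)
  right_mem : t ∈ V(G)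
  lt_left : k < cutSize G {s}
  lt_right : k < cutSize G {t}
  eq_of_lt : ∀ x ∈ X, x ∈ V(G) → k < cutSize G {x} → x = s

theorem exists_isTight_of_isAdmissibleRank [LinearOrder ι] {r : α → ι}
    (hr : IsAdmissibleRank G k ∅ r) (hs : s ∈ V(G)) :
    ∃ X, IsTight G s X ∧ cutSize G X ≤ k ∧ ∀ u ∈ X, u ∈ V(G) → r s ≤ r u := by
  obtain ⟨Y, hsY, -, hle, hYk⟩ := hr.exists_cut s hs (Set.notMem_empty s)
  obtain ⟨X, hmin⟩ := exists_minimalFor_of_wellFoundedLT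
    (fun X ↦ s ∈ X ∧ ∀ u ∈ X, u ∈ V(G) → r s ≤ r u) (cutSize G) ⟨Y, hsY, hle⟩
  obtain ⟨hsX, hX⟩ := hmin.prop
  exact ⟨X, ⟨hsX, fun Z hZX hsZ ↦ hmin.le ⟨hsZ, fun u hu ↦ hX u (hZX hu)⟩⟩,
    (hmin.le ⟨hsY, hle⟩).trans hYk, hX⟩

theorem exists_isSplittingCut [LinearOrder ι] {r : α → ι} (hG : V(G).Finite)
    (hr : IsAdmissibleRank G k ∅ r) (hlarge : ¬{v ∈ V(G) | k < cutSize G {v}}.Subsingleton) :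
    ∃ s t X, IsSplittingCut G k s t X := by
  have hne := Set.not_subsingleton_iff.1 hlarge
  obtain ⟨s, ⟨hs, hsk⟩, hmax⟩ :=
    Set.exists_max_image _ r (hG.subset (Set.sep_subset _ _)) hne.nonempty
  obtain ⟨t, ⟨ht, htk⟩, hts⟩ := hne.exists_ne s
  obtain ⟨X, hX, hXk, hle⟩ := exists_isTight_of_isAdmissibleRank hr hs
  have eq_of_lt : ∀ x ∈ X, x ∈ V(G) → k < cutSize G {x} → x = s := fun x hxX hx hxk ↦
    hr.injOn hx hs ((hmax x ⟨hx, hxk⟩).antisymm (hle x hxX hx))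
  exact ⟨s, t, X, hX, fun htX ↦ hts (eq_of_lt t htX ht htk), hXk, hs, ht, hsk, htk, eq_of_lt⟩

theorem exists_mem_ne_of_cutSize_ne (hs : s ∈ X) (h : cutSize G X ≠ cutSize G {s}) :
    ∃ x ∈ V(G), x ∈ X ∧ x ≠ s := by
  by_contra! hX
  refine h (cutSize_congr (Set.ext fun x ↦ ⟨fun ⟨hx, hxG⟩ ↦ ⟨hX x hxG hx, hxG⟩, ?_⟩))
  rintro ⟨rfl, hxG⟩
  exact ⟨hs, hxG⟩

/-- `G` is a `(≤ k)`-edge sum of the smaller graphs `G₁` and `G₂`, where `G₁` belongs to the class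
that generates the closure and the ordering given by `r` is still admissible for `G₂`. -/
structure IsPeeling [LinearOrder ι] (G : Graph α β) (k : ℕ) (r : α → ι) (G₁ G₂ : Graph α β) :
    Prop where
  almostBoundedEdgeDegree : AlmostBoundedEdgeDegree k G₁
  isFiniteLoopless : G₂.IsFiniteLoopless
  isAdmissibleRank : IsAdmissibleRank G₂ k ∅ r
  ssubset_left : V(G₁) ⊂ V(G)
  ssubset_right : V(G₂) ⊂ V(G)
  isEdgeSumLE : IsEdgeSumLE k G G₁ G₂

namespace IsSplittingCut

theorem exists_mem_ne (hX : IsSplittingCut G k s t X) : ∃ x ∈ V(G), x ∈ X ∧ x ≠ s :=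
  exists_mem_ne_of_cutSize_ne hX.isTight.mem (hX.cutSize_le.trans_lt hX.lt_left).ne

theorem exists_notMem_ne (hX : IsSplittingCut G k s t X) : ∃ x ∈ V(G), x ∈ Xᶜ ∧ x ≠ t :=
  exists_mem_ne_of_cutSize_ne hX.notMem
    ((cutSize_compl G X).trans_lt (hX.cutSize_le.trans_lt hX.lt_right)).ne

theorem almostBoundedEdgeDegree_deleteVerts (hX : IsSplittingCut G k s t X)
    (hG : G.IsFiniteLoopless) : AlmostBoundedEdgeDegree k (G.deleteVerts Xᶜ) := by
  have hle : G.deleteVerts Xᶜ ≤ G := deleteVerts_le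
  have hfin := isFiniteLoopless_anti hG hle
  have := hfin.loopless
  refine ⟨hfin, Set.subsingleton_of_forall_eq s fun x ⟨hx, hxk⟩ ↦ ?_⟩
  rw [vertexSet_deleteVerts, Set.sdiff_compl] at hx
  rw [edgeDegree_eq_cutSize_singleton] at hxk
  exact hX.eq_of_lt x hx.2 hx.1 (hxk.trans_le (cutSize_mono hle {x}))

theorem almostBoundedEdgeDegree_contract (hX : IsSplittingCut G k s t X)
    (hG : G.IsFiniteLoopless) : AlmostBoundedEdgeDegree k (contract G (collapse Xᶜ t)) := by
  refine ⟨isFiniteLoopless_contract hG _, Set.subsingleton_of_forall_eq s fun x ⟨hx, hxk⟩ ↦ ?_⟩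
  have hxt : x ≠ t := by
    rintro rfl
    rw [edgeDegree_contract_collapse (A := Xᶜ) hX.notMem, cutSize_compl] at hxk
    exact hxk.not_ge hX.cutSize_le
  obtain ⟨hxG, hxX⟩ := (mem_vertexSet_contract_collapse hxt).1 hx
  rw [edgeDegree_contract_collapse_of_notMem hxX hX.notMem] at hxk
  exact hX.eq_of_lt x (Set.notMem_compl_iff.1 hxX) hxG hxk

variable [LinearOrder ι] {r : α → ι}

theorem isPeeling_deleteVerts (hX : IsSplittingCut G k s t X) (hG : G.IsFiniteLoopless)
    (hr : IsAdmissibleRank G k ∅ r) (h₀ : cutSize G X = 0) :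
    IsPeeling G k r (G.deleteVerts Xᶜ) (G.deleteVerts X) := by
  have hle : G.deleteVerts X ≤ G := deleteVerts_le
  refine ⟨hX.almostBoundedEdgeDegree_deleteVerts hG,
    isFiniteLoopless_anti hG hle, hr.of_cutSize_le hle.vertexSet_mono (cutSize_mono hle),
    ?_, ?_, .inl (nonempty_iso_disjointUnion_of_cutSize_eq_zero h₀)⟩
  · exact Set.ssubset_iff_exists.2 ⟨Set.sdiff_subset, t, hX.right_mem, fun ht ↦ ht.2 hX.notMem⟩
  · exact Set.ssubset_iff_exists.2 ⟨Set.sdiff_subset, s, hX.left_mem, fun hs ↦ hs.2 hX.isTight.mem⟩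

theorem isPeeling_contract (hX : IsSplittingCut G k s t X) (hG : G.IsFiniteLoopless)
    (hr : IsAdmissibleRank G k ∅ r) (h₀ : cutSize G X ≠ 0) :
    IsPeeling G k r (contract G (collapse Xᶜ t)) (contract G (collapse X s)) := by
  have := hG.loopless
  have hfin : cutSize G X ≠ ⊤ := ne_top_of_le_ne_top (ENat.natCast_ne_top k) hX.cutSize_le
  obtain ⟨k', hk'⟩ := ENat.ne_top_iff_exists.1 hfin
  obtain ⟨x, hxG, hxX, hxs⟩ := hX.exists_mem_ne
  obtain ⟨y, hyG, hyX, hyt⟩ := hX.exists_notMem_ne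
  have hV₂ := vertexSet_contract_collapse_ssubset hX.left_mem hxG hxX hxs
  refine ⟨hX.almostBoundedEdgeDegree_contract hG, isFiniteLoopless_contract hG _,
    hr.of_cutSize_le hV₂.subset (hX.isTight.cutSize_contract_le hfin),
    vertexSet_contract_collapse_ssubset hX.right_mem hyG hyX hyt, hV₂, .inr ⟨k', ?_, ?_, ?_⟩⟩
  · rw [← hk', Nat.cast_ne_zero] at h₀
    exact Nat.one_le_iff_ne_zero.2 h₀
  · exact Nat.cast_le.1 (hk'.trans_le hX.cutSize_le)
  · exact isEdgeSum_contract_collapse hX.isTight.mem hX.notMem hX.left_mem hX.right_mem hk'.symm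

theorem exists_isPeeling (hX : IsSplittingCut G k s t X) (hG : G.IsFiniteLoopless)
    (hr : IsAdmissibleRank G k ∅ r) : ∃ G₁ G₂, IsPeeling G k r G₁ G₂ := by
  by_cases h₀ : cutSize G X = 0
  · exact ⟨_, _, hX.isPeeling_deleteVerts hG hr h₀⟩
  · exact ⟨_, _, hX.isPeeling_contract hG hr h₀⟩

end IsSplittingCut

end Decomposition

theorem edgeSumClosure_of_isAdmissibleRank.{w, z} {α : Type w} {β : Type z} {ι : Type*}
    [LinearOrder ι] {G : Graph α β} {k : ℕ} {r : α → ι} (hG : G.IsFiniteLoopless)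
    (hr : IsAdmissibleRank G k ∅ r) : EdgeSumClosure (AlmostBoundedEdgeDegree k) k G := by
  induction hn : V(G).ncard using Nat.strong_induction_on generalizing G with
  | _ n ih =>
  subst hn
  have := hG.loopless
  by_cases hlarge : {v ∈ V(G) | k < cutSize G {v}}.Subsingleton
  · exact .base ⟨hG, by simpa only [edgeDegree_eq_cutSize_singleton] using hlarge⟩
  obtain ⟨s, t, X, hX⟩ := exists_isSplittingCut hG.finite_vertexSet hr hlarge
  obtain ⟨G₁, G₂, hG₁, hG₂, hr₂, hV₁, hV₂, hsum⟩ := hX.exists_isPeeling hG hr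
  exact .sum (.base hG₁) (ih _ (Set.ncard_lt_ncard hV₂ hG.finite_vertexSet) hG₂ hr₂ rfl)
    ((hG.finite_vertexSet.subset hV₁.subset).encard_lt_encard hV₁)
    (hG₂.finite_vertexSet.encard_lt_encard hV₂) hsum

end EdgeAdmissibility

theorem mainTheorem1_general {α : Type u} {β : Type v} (G : Graph α β) (hG : G.IsFiniteLoopless)
    (k : ℕ) : G.edgeAdmissibility ≤ k ↔
      Graph.EdgeSumClosure (Graph.AlmostBoundedEdgeDegree k) k G := by
  refine ⟨fun h ↦ ?_, EdgeAdmissibility.edgeAdmissibility_le_of_edgeSumClosure hG.finite_vertexSet⟩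
  obtain ⟨r, hr⟩ := EdgeAdmissibility.exists_isAdmissibleRank_of_edgeAdmissibility_le h
  exact EdgeAdmissibility.edgeSumClosure_of_isAdmissibleRank hG hr

theorem mainTheorem1 {α : Type u} {β : Type v} (G : Graph α β)
    (hG : G.IsFiniteLoopless) :
    (∀ k : ℕ, G.edgeAdmissibility ≤ (k : ℕ∞) →
      Graph.EdgeSumClosure (Graph.AlmostBoundedEdgeDegree k) k G) ∧
    (∀ k : ℕ, 1 ≤ k → Graph.EdgeSumClosure (Graph.AlmostBoundedEdgeDegree k) k G →
      G.edgeAdmissibility ≤ ((2 * k - 1 : ℕ) : ℕ∞)) :=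
  ⟨fun k ↦ (mainTheorem1_general G hG k).1, fun k _ h ↦
    ((mainTheorem1_general G hG k).2 h).trans (Nat.cast_le.2 (by omega))⟩
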